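/- Let $\mathbb N=\{1,2,3,\dots\}$, let $m\ge 1$ and let all algebras and modules be over $\mathbb C$. In $\mathfrak{sl}(m+1)$ let $\mathfrak l=\mathrm{span}\{E_{i,j},\,E_{i,i}-E_{m+1,m+1}\mid 1\le i\ne j\le m\}$, $\mathfrak u=\mathrm{span}\{E_{s,m+1}\mid 1\le s\le m\}$, and let $\mathfrak p=\mathfrak l\oplus\mathfrak u$, a maximal parabolic subalgebra. Identify $\mathfrak l$ with $\mathfrak{gl}(m)$ by $E_{i,j}\mapsto E_{i,j}$ $(i\neq j)$ and $E_{i,i}-E_{m+1,m+1}\mapsto E_{i,i}$. Let $\mu=(\mu_1,\dots,\mu_m)\in\mathbb C^m$ satisfy, for some $\bar i\in\{1,\dots,m\}$, $$\mu_1=\dots=\mu_{\bar i},\qquad \mu_{\bar i+1}=\dots=\mu_m.$$ Let $V=L(\mu)$ be the simple highest weight $\mathfrak{gl}(m)$-module of highest weight $\mu$, that is, the (up to isomorphism unique) simple module with a nonzero vector $v_\mu$ such that $E_{i,j}v_\mu=0$ for $i<j$ and $E_{i,i}v_\mu=\mu_iv_\mu$ for all $i$. Regard $V$ as a $\mathfrak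 p$-module with $\mathfrak uV=0$, and let $M_{\mathfrak p}(V)=U(\mathfrak{sl}(m+1))\otimes_{U(\mathfrak p)}V$ be the generalized Verma module. Then the $\mathfrak{sl}(m+1)$-module $M_{\mathfrak p}(V)$ is not simple if and only if at least one of the following holds: 1. $\bar i\neq m$, $l:=\mu_{\bar i}+m+1-\bar i\in\mathbb N$, and $\mu_{\bar i}-\mu_{\bar i+1}\notin\{0,1,\dots,l-1\}$; 2. $\mu_m+1\in\mathbb N$. -/

import Mathlib

open scoped TensorProduct

-- The commutator bracket on an associative ring, in particular on square matrices.
attribute [local instance 100] LieRing.ofAssociativeRing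

namespace GVM

/-! ### Induced modules -/

section Induced

variable (R : Type*) {L : Type*} [CommRing R] [LieRing L] [LieAlgebra R L]
variable (K : LieSubalgebra R L)
variable (W : Type*) [AddCommGroup W] [Module R W] [LieRingModule K W]

/-- The `U(L)`-submodule of `U(L) ⊗[R] W` generated by the elements
`x k ⊗ w - x ⊗ k w` with `x ∈ U(L)`, `k ∈ K`, `w ∈ W`. -/
noncomputable def inducedRel :
    Submodule (UniversalEnvelopingAlgebra R L) (UniversalEnvelopingAlgebra R L ⊗[R] W) :=
  Submodule.span (UniversalEnvelopingAlgebra R L)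
    {t | ∃ (x : UniversalEnvelopingAlgebra R L) (k : K) (w : W),
      t = (x * UniversalEnvelopingAlgebra.ι R (k : L)) ⊗ₜ[R] w - x ⊗ₜ[R] ⁅k, w⁆}

/-- The induced module `U(L) ⊗_{U(K)} W`: the tensor product over the noncommutative ring `U(K)`,
that is the quotient of `U(L) ⊗[R] W` by the relations `x k ⊗ w = x ⊗ k w`
(`K` generates `U(K)` as an `R`-algebra). -/
def Induced : Type _ :=
  (UniversalEnvelopingAlgebra R L ⊗[R] W) ⧸ inducedRel R K W

noncomputable instance : AddCommGroup (Induced R K W) :=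
  inferInstanceAs (AddCommGroup ((UniversalEnvelopingAlgebra R L ⊗[R] W) ⧸ inducedRel R K W))

noncomputable instance : Module (UniversalEnvelopingAlgebra R L) (Induced R K W) :=
  inferInstanceAs (Module (UniversalEnvelopingAlgebra R L)
    ((UniversalEnvelopingAlgebra R L ⊗[R] W) ⧸ inducedRel R K W))

noncomputable instance : Module R (Induced R K W) :=
  inferInstanceAs (Module R ((UniversalEnvelopingAlgebra R L ⊗[R] W) ⧸ inducedRel R K W))

instance : IsScalarTower R (UniversalEnvelopingAlgebra R L) (Induced R K W) :=
  inferInstanceAs (IsScalarTower R (UniversalEnvelopingAlgebra R L)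
    ((UniversalEnvelopingAlgebra R L ⊗[R] W) ⧸ inducedRel R K W))

/-- The quotient map `U(L) ⊗[R] W → U(L) ⊗_{U(K)} W`. -/
noncomputable def Induced.mk : (UniversalEnvelopingAlgebra R L ⊗[R] W)
    →ₗ[UniversalEnvelopingAlgebra R L] Induced R K W :=
  (inducedRel R K W).mkQ

/-- `L` acts on the induced module through left multiplication by `L ⊆ U(L)`. -/
noncomputable instance : LieRingModule L (Induced R K W) where
  bracket y z := UniversalEnvelopingAlgebra.ι R y • z
  add_lie x y z := by
    change UniversalEnvelopingAlgebra.ι R (x + y) • z = _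
    rw [map_add, add_smul]
  lie_add x y z := smul_add _ _ _
  leibniz_lie x y z := by
    change UniversalEnvelopingAlgebra.ι R x • (UniversalEnvelopingAlgebra.ι R y • z) =
      UniversalEnvelopingAlgebra.ι R ⁅x, y⁆ • z +
        UniversalEnvelopingAlgebra.ι R y • (UniversalEnvelopingAlgebra.ι R x • z)
    rw [LieHom.map_lie, LieRing.of_associative_ring_bracket, sub_smul, mul_smul, mul_smul]
    abel

theorem lie_def (y : L) (z : Induced R K W) :
    ⁅y, z⁆ = UniversalEnvelopingAlgebra.ι R y • z := rfl

instance : LieModule R L (Induced R K W) where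
  smul_lie t x z := by
    rw [lie_def, lie_def, map_smul, smul_assoc]
  lie_smul t x z := by
    rw [lie_def, lie_def, ← algebraMap_smul (UniversalEnvelopingAlgebra R L) t z,
      ← algebraMap_smul (UniversalEnvelopingAlgebra R L) t
        (UniversalEnvelopingAlgebra.ι R x • z), ← mul_smul, ← mul_smul, Algebra.commutes]

end Induced

/-! ### The Lie algebras -/

/-- The general linear Lie algebra `gl(m)` over `ℂ`. -/
abbrev gl (m : ℕ) : Type := Matrix (Fin m) (Fin m) ℂ

/-- The special linear Lie algebra `sl(m + 1)` over `ℂ`. -/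
abbrev sl (m : ℕ) : LieSubalgebra ℂ (Matrix (Fin (m + 1)) (Fin (m + 1)) ℂ) :=
  LieAlgebra.SpecialLinear.sl (Fin (m + 1)) ℂ

/-- The maximal parabolic subalgebra `p = l ⊕ u` of `sl(m + 1)`: traceless matrices whose last row
vanishes outside the diagonal. Here `l` is spanned by the `E_{i,j}` and `E_{i,i} - E_{m+1,m+1}`
and `u` by the `E_{i,m+1}`, for `i ≠ j` in `{1, …, m}`. -/
def parabolic (m : ℕ) : LieSubalgebra ℂ (sl m) where
  carrier := {A | ∀ j : Fin m, (A : Matrix (Fin (m + 1)) (Fin (m + 1)) ℂ) (Fin.last m) j.castSucc = 0}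
  zero_mem' := fun _ => rfl
  add_mem' := by
    intro A B hA hB j
    simp only [Set.mem_ofPred_eq] at hA hB
    simp [hA j, hB j]
  smul_mem' := by
    intro c A hA j
    simp only [Set.mem_ofPred_eq] at hA
    simp [hA j]
  lie_mem' := by
    intro A B hA hB j
    change ∀ j : Fin m, (A : Matrix (Fin (m + 1)) (Fin (m + 1)) ℂ) _ _ = 0 at hA
    change ∀ j : Fin m, (B : Matrix (Fin (m + 1)) (Fin (m + 1)) ℂ) _ _ = 0 at hB
    rw [LieAlgebra.SpecialLinear.sl_bracket]
    simp [Matrix.mul_apply, Fin.sum_univ_castSucc, hA, hB]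

/-- The upper left `m × m` block. On `l` it is the isomorphism `l ≅ gl(m)` sending `E_{i,j}` to
`E_{i,j}` and `E_{i,i} - E_{m+1,m+1}` to `E_{i,i}`, and it vanishes on `u`. -/
def leviProj (m : ℕ) : parabolic m →ₗ⁅ℂ⁆ gl m where
  toFun A := ((A : sl m) : Matrix (Fin (m + 1)) (Fin (m + 1)) ℂ).submatrix
    Fin.castSucc Fin.castSucc
  map_add' _ _ := rfl
  map_smul' _ _ := rfl
  map_lie' := by
    rintro ⟨A, hA⟩ ⟨B, hB⟩
    change ∀ j : Fin m, (A : Matrix (Fin (m + 1)) (Fin (m + 1)) ℂ) _ _ = 0 at hA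
    change ∀ j : Fin m, (B : Matrix (Fin (m + 1)) (Fin (m + 1)) ℂ) _ _ = 0 at hB
    ext i j
    simp [LieRing.of_associative_ring_bracket, Matrix.mul_apply, Fin.sum_univ_castSucc, hA, hB]

/-! ### The generalized Verma module -/

section Verma

variable (m : ℕ) (V : Type*) [AddCommGroup V] [Module ℂ V]
  [LieRingModule (gl m) V] [LieModule ℂ (gl m) V]

/-- The `gl(m)`-module `V` regarded as a `p`-module: `l ≅ gl(m)` acts as before, `u` acts by `0`. -/
def Inflation (_m : ℕ) (V : Type*) : Type _ := V

instance : AddCommGroup (Inflation m V) := inferInstanceAs (AddCommGroup V)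

instance : Module ℂ (Inflation m V) := inferInstanceAs (Module ℂ V)

instance : LieRingModule (parabolic m) (Inflation m V) :=
  LieRingModule.compLieHom V (leviProj m)

instance : LieModule ℂ (parabolic m) (Inflation m V) :=
  LieModule.compLieHom V (leviProj m)

/-- The generalized Verma module `M_p(V) = U(sl(m + 1)) ⊗_{U(p)} V`. -/
abbrev GeneralizedVerma : Type _ := Induced ℂ (parabolic m) (Inflation m V)

end Verma

/-- `V` is the simple highest weight `gl(m)`-module `L(μ)`: a simple module that has a nonzero
vector `v` with `E_{i,j} v = 0` for `i < j` and `E_{i,i} v = μ_i v`. This determines `V` up to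
isomorphism: such a `V` is the unique simple quotient of the Verma module `M(μ)`. -/
structure IsSimpleHighestWeight {m : ℕ} (μ : Fin m → ℂ) (V : Type*) [AddCommGroup V] [Module ℂ V]
    [LieRingModule (gl m) V] [LieModule ℂ (gl m) V] : Prop where
  irreducible : LieModule.IsIrreducible ℂ (gl m) V
  exists_highestWeightVector : ∃ v : V, v ≠ 0 ∧
    (∀ i j : Fin m, i < j → ⁅(Matrix.single i j (1 : ℂ) : gl m), v⁆ = 0) ∧
    ∀ i : Fin m, ⁅(Matrix.single i i (1 : ℂ) : gl m), v⁆ = μ i • v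

end GVM

set_option linter.unusedSectionVars false

namespace GVM

/-! ### Bracket computations in the tensor product of a Weyl algebra with `U(gl)` -/

/-! As a vector space `M_p(V)` is `ℂ[y_1, …, y_m] ⊗ V`. There `E_{m+1,t}` acts as `y_t`, `E_{s,t}`
as `e_{s,t} - y_t ∂_s` (`levi`), and `E_{s,m+1}` as `∑_t levi s t * ∂_t` (`raise`);
`toModel_bijective` identifies the two modules. A lowest-degree argument shows that the module is
reducible exactly when, for some `k > 0`, there is a nonzero vector of degree `k` killed by every
`raise s` (`exists_singular`, `not_isIrreducible_of_singular`).

Necessity. The singular vectors of degree `k` form a Levi module, so one functional detects them: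
`φ` with `φ v = 1` that kills the image of the strictly lower triangular matrices
(`exists_isTopFunctional`, `eq_zero_of_contract`). For singular `z`, the contraction `Q = contract φ
z` is homogeneous of degree `k`, and the equations `raise s z = 0` become differential equations for
`Q`. For `s` in the second block, `(μ_s + 1 - k) ∂_s Q = 0`. Unless `k = μ_m + 1`, this removes the
second-block variables, and then `(μ_s + m + 1 - ibar - k) ∂_s Q = 0` for `s` in the first block,
which forces `k = l`. If moreover `μ_ibar - μ_{ibar+1} = n < k`, then `φ ∘ e_{ibar,ibar+1}^(n+1) =
0` by `sl(2)` theory; this yields `∂_ibar^(n+1) Q = 0`, and a descent in the exponent gives `Q = 0`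
(`contract_eq_zero_of_natCast`).

Sufficiency. In case 2 the vector `y_m^k ⊗ v` is singular. In case 1, with `i = ibar`, a combination
of the vectors `y_i^q (∑_{t>i} y_t e_{t,i})^r (1 ⊗ v)`, `q + r = l`, is singular; its `y_i^l`
coefficient is a nonzero multiple of `∏_{j<l} (μ_i - μ_{i+1} - j)` (`exists_singular_of_block`). -/

theorem bracket_mul {A : Type*} [Ring A] (a b c : A) : ⁅a, b * c⁆ = ⁅a, b⁆ * c + b * ⁅a, c⁆ := by
  simp only [LieRing.of_associative_ring_bracket]; noncomm_ring

theorem mul_bracket {A : Type*} [Ring A] (a b c : A) : ⁅a * b, c⁆ = a * ⁅b, c⁆ + ⁅a, c⁆ * b := by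
  simp only [LieRing.of_associative_ring_bracket]; noncomm_ring

theorem mul_eq_add_bracket {A : Type*} [Ring A] (a b : A) : a * b = b * a + ⁅a, b⁆ := by
  simp only [LieRing.of_associative_ring_bracket]; noncomm_ring

/-- Elements of a ring satisfying the relations of `y_s`, `∂/∂y_s` and, commuting with these,
of the matrix units `e_{s,t}` of `gl`. -/
structure WeylGL (σ A : Type*) [DecidableEq σ] [Ring A] where
  y : σ → A
  d : σ → A
  e : σ → σ → A
  y_y : ∀ s t, ⁅y s, y t⁆ = 0
  d_d : ∀ s t, ⁅d s, d t⁆ = 0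
  d_y : ∀ s t, ⁅d s, y t⁆ = if s = t then 1 else 0
  e_y : ∀ s t r, ⁅e s t, y r⁆ = 0
  e_d : ∀ s t r, ⁅e s t, d r⁆ = 0
  e_e : ∀ s t q r, ⁅e s t, e q r⁆ = (if t = q then e s r else 0) - (if r = s then e q t else 0)

namespace WeylGL

variable {σ A : Type*} [DecidableEq σ] [Ring A] (D : WeylGL σ A)

/-- The action of the Levi factor. -/
def levi (s t : σ) : A := D.e s t - D.y t * D.d s

theorem y_d (s t : σ) : ⁅D.y s, D.d t⁆ = -(if t = s then 1 else 0) := by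
  rw [← lie_skew, D.d_y]

theorem y_e (r s t : σ) : ⁅D.y r, D.e s t⁆ = 0 := by rw [← lie_skew, D.e_y, neg_zero]

theorem d_e (r s t : σ) : ⁅D.d r, D.e s t⁆ = 0 := by rw [← lie_skew, D.e_d, neg_zero]

theorem d_mul_d (s r : σ) : D.d s * D.d r = D.d r * D.d s := by
  rw [mul_eq_add_bracket, D.d_d, add_zero]

theorem levi_y (s t r : σ) : ⁅D.levi s t, D.y r⁆ = -(if r = s then D.y t else 0) := by
  simp only [levi, sub_lie, D.e_y, mul_bracket, D.y_y, D.d_y]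
  split_ifs with h h' <;> simp_all

theorem levi_d (s t r : σ) : ⁅D.levi s t, D.d r⁆ = if t = r then D.d s else 0 := by
  simp only [levi, sub_lie, D.e_d, mul_bracket, D.d_d, D.y_d]
  split_ifs with h h' <;> simp_all

theorem levi_levi (s t q r : σ) : ⁅D.levi s t, D.levi q r⁆ =
    (if t = q then D.levi s r else 0) - (if r = s then D.levi q t else 0) := by
  have h : ⁅D.levi s t, D.e q r⁆ = ⁅D.e s t, D.e q r⁆ := by
    rw [levi, sub_lie, mul_bracket, D.d_e, D.y_e]
    simp
  conv_lhs => rw [levi.eq_def D q r]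
  rw [lie_sub, bracket_mul, D.levi_y, D.levi_d, h, D.e_e]
  simp only [levi]
  split_ifs <;> simp [sub_eq_add_neg, add_assoc, add_comm, add_left_comm]

variable [Fintype σ]

/-- The Euler operator `∑ y_t ∂_t`. -/
def euler : A := ∑ t, D.y t * D.d t

/-- The action of the nilradical. -/
def raise (s : σ) : A := ∑ t, D.levi s t * D.d t

theorem euler_y (s : σ) : ⁅D.euler, D.y s⁆ = D.y s := by
  simp [euler, sum_lie, mul_bracket, D.y_y, D.d_y]

theorem euler_d (s : σ) : ⁅D.euler, D.d s⁆ = -D.d s := by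
  simp [euler, sum_lie, mul_bracket, D.d_d, D.y_d]

theorem e_euler (s t : σ) : ⁅D.e s t, D.euler⁆ = 0 := by
  simp [euler, lie_sum, bracket_mul, D.e_y, D.e_d]

theorem levi_euler (s t : σ) : ⁅D.levi s t, D.euler⁆ = 0 := by
  have h (x : A) : ⁅x, D.euler⁆ = -⁅D.euler, x⁆ := (lie_skew _ _).symm
  rw [levi, sub_lie, D.e_euler, mul_bracket, h, h, D.euler_y, D.euler_d]
  simp

theorem euler_levi (s t : σ) : ⁅D.euler, D.levi s t⁆ = 0 := by
  rw [← lie_skew, levi_euler, neg_zero]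

theorem euler_raise (s : σ) : ⁅D.euler, D.raise s⁆ = -D.raise s := by
  simp [raise, lie_sum, bracket_mul, D.euler_levi, D.euler_d]

theorem levi_raise (s t r : σ) : ⁅D.levi s t, D.raise r⁆ = if t = r then D.raise s else 0 := by
  simp only [raise, lie_sum, bracket_mul, D.levi_levi, D.levi_d, sub_mul, ite_mul, zero_mul,
    mul_ite, mul_zero, Finset.sum_add_distrib, Finset.sum_sub_distrib]
  by_cases h : t = r <;> simp [h]

theorem raise_y (s r : σ) :
    ⁅D.raise s, D.y r⁆ = D.levi s r - (if r = s then D.euler else 0) := by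
  simp only [raise, sum_lie, mul_bracket, D.d_y, D.levi_y]
  by_cases h : r = s <;> simp [h, Finset.sum_add_distrib, euler, sub_eq_add_neg]

theorem raise_d (s r : σ) : ⁅D.raise s, D.d r⁆ = D.d s * D.d r := by
  simp [raise, sum_lie, mul_bracket, D.d_d, D.levi_d]

/-- The two contributions, from moving past the `∂_q` and past the `levi r q`, cancel because the
derivatives commute. -/
theorem raise_raise (s r : σ) : ⁅D.raise s, D.raise r⁆ = 0 := by
  have h (q : σ) : ⁅D.raise s, D.levi r q⁆ = -(if q = s then D.raise r else 0) := by
    rw [← lie_skew, D.levi_raise]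
  conv_lhs => rw [raise.eq_def D r]
  simp only [lie_sum, bracket_mul, D.raise_d, h, Finset.sum_add_distrib, neg_mul, ite_mul,
    zero_mul, Finset.sum_neg_distrib, Finset.sum_ite_eq', Finset.mem_univ, if_true]
  simp only [raise, Finset.sum_mul, mul_assoc, D.d_mul_d s]
  simp

end WeylGL

/-- Elements `E a b` of an algebra satisfying the relations of matrix units for the commutator
define a representation of the general linear Lie algebra. -/
def matrixLieHom {n A : Type*} [Fintype n] [DecidableEq n] [Ring A] [Algebra ℂ A] (E : n → n → A)
    (h : ∀ a b c d, ⁅E a b, E c d⁆ = (if b = c then E a d else 0) - (if d = a then E c b else 0)) :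
    Matrix n n ℂ →ₗ⁅ℂ⁆ A where
  toFun M := ∑ a, ∑ b, M a b • E a b
  map_add' M N := by simp [add_smul, Finset.sum_add_distrib]
  map_smul' c M := by simp [mul_smul, Finset.smul_sum]
  map_lie' {M N} := by
    have h1 : ∑ a, ∑ b, (M * N) a b • E a b = ∑ a, ∑ b, ∑ c, (M a c * N c b) • E a b := by
      simp [Matrix.mul_apply, Finset.sum_smul]
    have h2 : ∑ a, ∑ b, (N * M) a b • E a b = ∑ a, ∑ b, ∑ c, (N a c * M c b) • E a b := by
      simp [Matrix.mul_apply, Finset.sum_smul]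
    simp only [LieRing.of_associative_ring_bracket (A := Matrix n n ℂ), Matrix.sub_apply, sub_smul,
      Finset.sum_sub_distrib, h1, h2]
    have h3 : ⁅∑ a, ∑ b, M a b • E a b, ∑ a, ∑ b, N a b • E a b⁆ =
        ∑ a, ∑ b, ∑ c, ∑ d, (M a b * N c d) • ⁅E a b, E c d⁆ := by
      simp_rw [sum_lie, lie_sum, smul_lie, lie_smul, smul_smul]
    rw [h3]
    simp only [h, smul_sub, Finset.sum_sub_distrib, smul_ite, smul_zero]
    congr 1
    · refine Finset.sum_congr rfl fun a _ => ?_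
      rw [Finset.sum_comm]
      refine Finset.sum_congr rfl fun b _ => ?_
      rw [Finset.sum_comm]
      simp
    · simp only [Finset.sum_ite_eq', Finset.mem_univ, if_true]
      refine (Finset.sum_congr rfl fun a _ => Finset.sum_comm).trans ?_
      rw [Finset.sum_comm]
      refine Finset.sum_congr rfl fun c _ => ?_
      rw [Finset.sum_comm]
      simp only [mul_comm]

/-! ### Assembling the matrix units of `gl(m + 1)` -/

namespace WeylGL

variable {m : ℕ} {A : Type*} [Ring A] (D : WeylGL (Fin m) A)

/-- The action of the matrix units of `gl(m + 1)`. -/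
def unit (a b : Fin (m + 1)) : A :=
  Fin.lastCases (motive := fun _ => A) (Fin.lastCases (motive := fun _ => A) D.euler D.y b)
    (fun s => Fin.lastCases (motive := fun _ => A) (D.raise s) (D.levi s) b) a

@[simp] theorem unit_last_last : D.unit (Fin.last m) (Fin.last m) = D.euler := by simp [unit]

@[simp] theorem unit_last_castSucc (t : Fin m) : D.unit (Fin.last m) t.castSucc = D.y t := by
  simp [unit]

@[simp] theorem unit_castSucc_last (s : Fin m) : D.unit s.castSucc (Fin.last m) = D.raise s := by
  simp [unit]

@[simp] theorem unit_castSucc_castSucc (s t : Fin m) :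
    D.unit s.castSucc t.castSucc = D.levi s t := by
  simp [unit]

/-- Splitting each index into `last` or `castSucc` leaves sixteen brackets. Most are known in one
order only, so their skew forms are supplied as rewrite rules. -/
theorem unit_unit (a b c d : Fin (m + 1)) : ⁅D.unit a b, D.unit c d⁆ =
    (if b = c then D.unit a d else 0) - (if d = a then D.unit c b else 0) := by
  have hskew (x y : A) : ⁅x, y⁆ = -⁅y, x⁆ := (lie_skew _ _).symm
  have h1 (s : Fin m) : Fin.last m ≠ s.castSucc := (Fin.castSucc_ne_last s).symm
  have h2 (s t r : Fin m) := hskew (D.y r) (D.levi s t)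
  have h3 (s r : Fin m) := hskew (D.y r) (D.raise s)
  have h4 (s t r : Fin m) := hskew (D.raise r) (D.levi s t)
  have h5 (s : Fin m) := hskew (D.y s) D.euler
  have h6 (s : Fin m) := hskew (D.raise s) D.euler
  induction a using Fin.lastCases <;> induction b using Fin.lastCases <;>
  induction c using Fin.lastCases <;> induction d using Fin.lastCases <;>
  simp [h1, h2, h3, h4, h5, h6, D.euler_y, D.euler_raise, D.levi_euler, D.euler_levi, D.levi_levi,
    D.levi_raise, D.levi_y, D.raise_y, D.raise_raise, D.y_y, eq_comm]

end WeylGL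

end GVM

namespace GVM

/-! ### Submodules generated by highest weight spaces -/

section Triangular

variable {R L M : Type*} [CommRing R] [LieRing L] [LieAlgebra R L] [AddCommGroup M] [Module R M]
  [LieRingModule L M] [LieModule R L M]

/-- If `L` is spanned by `B ∪ N`, then the Lie submodule generated by a `B`-stable subspace `U` is
the smallest subspace that contains `U` and is stable under `N`. -/
theorem lieSpan_le_of_span_union_eq_top {B N : Set L} (hBN : Submodule.span R (B ∪ N) = ⊤)
    {U K : Submodule R M} (hB : ∀ b ∈ B, ∀ x ∈ U, ⁅b, x⁆ ∈ U) (hUK : U ≤ K)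
    (hN : ∀ n ∈ N, ∀ x ∈ K, ⁅n, x⁆ ∈ K) :
    (LieSubmodule.lieSpan R L (U : Set M)).toSubmodule ≤ K := by
  set W : Submodule R M := sInf {K | U ≤ K ∧ ∀ n ∈ N, ∀ x ∈ K, ⁅n, x⁆ ∈ K} with hW
  have hUW : U ≤ W := le_sInf fun K hK => hK.1
  have hNW : ∀ n ∈ N, ∀ x ∈ W, ⁅n, x⁆ ∈ W := by
    intro n hn x hx
    rw [hW, Submodule.mem_sInf] at hx ⊢
    exact fun K hK => hK.2 n hn x (hx K hK)
  -- By minimality of `W` it suffices that the vectors of `W` all of whose `L`-translates stay in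
  -- `W` contain `U` and are `N`-stable; stability is the Leibniz rule.
  let W' : Submodule R M :=
    { carrier := {x | x ∈ W ∧ ∀ g : L, ⁅g, x⁆ ∈ W}
      zero_mem' := ⟨W.zero_mem, fun g => by simp⟩
      add_mem' := fun ha hb =>
        ⟨W.add_mem ha.1 hb.1, fun g => by rw [lie_add]; exact W.add_mem (ha.2 g) (hb.2 g)⟩
      smul_mem' := fun c x hx =>
        ⟨W.smul_mem c hx.1, fun g => by rw [lie_smul]; exact W.smul_mem c (hx.2 g)⟩ }
  have hWW' : W ≤ W' := by
    refine sInf_le ⟨fun x hx => ⟨hUW hx, fun g => ?_⟩, fun n hn x hx => ⟨hx.2 n, fun g => ?_⟩⟩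
    · have hg : g ∈ Submodule.span R (B ∪ N) := hBN ▸ Submodule.mem_top
      induction hg using Submodule.span_induction with
      | mem g hg =>
        rcases hg with hg | hg
        · exact hUW (hB g hg x hx)
        · exact hNW g hg x (hUW hx)
      | zero => simp
      | add a b _ _ ha hb => rw [add_lie]; exact W.add_mem ha hb
      | smul c a _ ha => rw [smul_lie]; exact W.smul_mem c ha
    · rw [leibniz_lie]
      exact W.add_mem (hx.2 _) (hNW n hn _ (hx.2 g))
  have hle : LieSubmodule.lieSpan R L (U : Set M) ≤
      { W with lie_mem := fun {g x} hx => (hWW' hx).2 g } :=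
    LieSubmodule.lieSpan_le.mpr hUW
  exact fun x hx => (Submodule.mem_sInf.mp (hle hx : x ∈ W)) K ⟨hUK, hN⟩

end Triangular

/-! ### The polynomial model of the generalized Verma module -/

section Model

open MvPolynomial

variable {m : ℕ} {V : Type*} [AddCommGroup V] [Module ℂ V]
  [LieRingModule (gl m) V] [LieModule ℂ (gl m) V]

theorem bracket_single {n : Type*} [Fintype n] [DecidableEq n] (s t q r : n) :
    ⁅(Matrix.single s t 1 : Matrix n n ℂ), (Matrix.single q r 1 : Matrix n n ℂ)⁆ =
      (if t = q then Matrix.single s r 1 else 0) - (if r = s then Matrix.single q t 1 else 0) := by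
  rw [LieRing.of_associative_ring_bracket]
  congr 1
  · split_ifs with h
    · subst h; simp
    · simp [h]
  · split_ifs with h
    · subst h; simp
    · simp [h]

theorem pderiv_pderiv_comm {σ : Type*} (s t : σ) (P : MvPolynomial σ ℂ) :
    pderiv s (pderiv t P) = pderiv t (pderiv s P) := by
  ext k
  simp only [coeff_pderiv]
  rw [add_right_comm]
  by_cases h : s = t
  · subst h; ring
  · simp [h, Ne.symm h]; ring

variable (m V) in
/-- Differential operators on `ℂ[y_1, …, y_m]` and matrix units of `gl(m)` acting on
`ℂ[y_1, …, y_m] ⊗ V`. -/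
noncomputable def ops : WeylGL (Fin m) (Module.End ℂ (MvPolynomial (Fin m) ℂ ⊗[ℂ] V)) where
  y s := (LinearMap.mulLeft ℂ (X s)).rTensor V
  d s := (pderiv s : Derivation ℂ _ _).toLinearMap.rTensor V
  e s t := (LieModule.toEnd ℂ (gl m) V (Matrix.single s t 1)).lTensor _
  y_y s t := TensorProduct.ext' fun P v => by
    simp [LieRing.of_associative_ring_bracket, mul_left_comm]
  d_d s t := TensorProduct.ext' fun P v => by
    simp [LieRing.of_associative_ring_bracket, pderiv_pderiv_comm s t]
  d_y s t := TensorProduct.ext' fun P v => by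
    split_ifs with h
    · subst h; simp [LieRing.of_associative_ring_bracket, TensorProduct.add_tmul]
    · simp [LieRing.of_associative_ring_bracket, pderiv_X_of_ne (Ne.symm h)]
  e_y s t r := TensorProduct.ext' fun P v => by
    simp [LieRing.of_associative_ring_bracket]
  e_d s t r := TensorProduct.ext' fun P v => by
    simp [LieRing.of_associative_ring_bracket]
  e_e s t q r := TensorProduct.ext' fun P v => by
    have h := congrArg (fun x : gl m => P ⊗ₜ[ℂ] ⁅x, v⁆) (bracket_single s t q r)
    simp only [lie_lie, sub_lie, TensorProduct.tmul_sub] at h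
    rw [LieRing.of_associative_ring_bracket]
    split_ifs at h ⊢ <;> simpa using h

@[simp] theorem ops_y_tmul (s : Fin m) (P : MvPolynomial (Fin m) ℂ) (v : V) :
    (ops m V).y s (P ⊗ₜ v) = (X s * P) ⊗ₜ v := rfl

@[simp] theorem ops_d_tmul (s : Fin m) (P : MvPolynomial (Fin m) ℂ) (v : V) :
    (ops m V).d s (P ⊗ₜ v) = (pderiv s P) ⊗ₜ v := rfl

@[simp] theorem ops_e_tmul (s t : Fin m) (P : MvPolynomial (Fin m) ℂ) (v : V) :
    (ops m V).e s t (P ⊗ₜ v) = P ⊗ₜ ⁅(Matrix.single s t 1 : gl m), v⁆ := rfl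

variable (m V) in
/-- The action of `gl(m + 1)` on `ℂ[y_1, …, y_m] ⊗ V`. -/
noncomputable def modelHom : Matrix (Fin (m + 1)) (Fin (m + 1)) ℂ →ₗ⁅ℂ⁆
    Module.End ℂ (MvPolynomial (Fin m) ℂ ⊗[ℂ] V) :=
  matrixLieHom (ops m V).unit (ops m V).unit_unit

theorem modelHom_apply (M : Matrix (Fin (m + 1)) (Fin (m + 1)) ℂ) :
    modelHom m V M = ∑ a, ∑ b, M a b • (ops m V).unit a b := rfl

noncomputable instance : LieRingModule (sl m) (MvPolynomial (Fin m) ℂ ⊗[ℂ] V) :=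
  LieRingModule.compLieHom _ ((modelHom m V).comp (sl m).incl)

instance : LieModule ℂ (sl m) (MvPolynomial (Fin m) ℂ ⊗[ℂ] V) :=
  LieModule.compLieHom _ ((modelHom m V).comp (sl m).incl)

theorem model_lie (A : sl m) (z : MvPolynomial (Fin m) ℂ ⊗[ℂ] V) :
    ⁅A, z⁆ = modelHom m V (A : Matrix (Fin (m + 1)) (Fin (m + 1)) ℂ) z := rfl

theorem modelHom_single (a b : Fin (m + 1)) :
    modelHom m V (Matrix.single a b 1) = (ops m V).unit a b := by
  rw [modelHom_apply, Finset.sum_eq_single a, Finset.sum_eq_single b] <;>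
    simp +contextual [Matrix.single_apply, eq_comm]

end Model

end GVM

namespace GVM

/-! ### The generalized Verma module is isomorphic to the polynomial model -/

section Comparison

open MvPolynomial UniversalEnvelopingAlgebra

open scoped IsMulCommutative in
-- Evaluation of polynomials needs a commutative target, so it is carried out in the subalgebra
-- generated by the commuting family.
theorem exists_algHom_of_commute {σ A : Type*} [Ring A] [Algebra ℂ A] (a : σ → A)
    (h : ∀ s t, a s * a t = a t * a s) :
    ∃ θ : MvPolynomial σ ℂ →ₐ[ℂ] A, ∀ s, θ (X s) = a s := by
  have : IsMulCommutative (Algebra.adjoin ℂ (Set.range a)) :=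
    Algebra.isMulCommutative_adjoin ℂ (by rintro _ ⟨s, rfl⟩ _ ⟨t, rfl⟩; exact h s t)
  refine ⟨(Algebra.adjoin ℂ (Set.range a)).val.comp
    (aeval fun s => ⟨a s, Algebra.subset_adjoin ⟨s, rfl⟩⟩), fun s => ?_⟩
  rw [AlgHom.comp_apply, aeval_X]
  rfl

variable {m : ℕ} {V : Type*} [AddCommGroup V] [Module ℂ V]
  [LieRingModule (gl m) V] [LieModule ℂ (gl m) V]

theorem ops_levi_one_tmul (s t : Fin m) (v : V) :
    (ops m V).levi s t (1 ⊗ₜ v) = 1 ⊗ₜ ⁅(Matrix.single s t 1 : gl m), v⁆ := by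
  simp [WeylGL.levi]

theorem ops_euler_one_tmul (v : V) : (ops m V).euler (1 ⊗ₜ v) = 0 := by
  simp [WeylGL.euler]

theorem ops_raise_one_tmul (s : Fin m) (v : V) : (ops m V).raise s (1 ⊗ₜ v) = 0 := by
  simp [WeylGL.raise]

theorem sum_lie_single (A : gl m) (v : V) :
    ∑ s, ∑ t, A s t • ⁅(Matrix.single s t 1 : gl m), v⁆ = ⁅A, v⁆ := by
  conv_rhs => rw [Matrix.matrix_eq_sum_single A]
  simp only [sum_lie, ← smul_lie, Matrix.smul_single, smul_eq_mul, mul_one]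

/-- All derivatives kill `1 ⊗ v`, so only the `e_{s,t}` survive. This is the relation that makes the
map out of the induced module well defined. -/
theorem modelHom_one_tmul (k : parabolic m) (v : V) :
    modelHom m V ((k : sl m) : Matrix (Fin (m + 1)) (Fin (m + 1)) ℂ) (1 ⊗ₜ v) =
      1 ⊗ₜ ⁅leviProj m k, v⁆ := by
  have hk : ∀ j : Fin m,
    ((k : sl m) : Matrix (Fin (m + 1)) (Fin (m + 1)) ℂ) (Fin.last m) j.castSucc = 0 := k.2
  rw [modelHom_apply, ← sum_lie_single]
  simp only [Fin.sum_univ_castSucc, hk, LinearMap.add_apply, LinearMap.sum_apply,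
    LinearMap.smul_apply, WeylGL.unit_castSucc_castSucc, WeylGL.unit_castSucc_last,
    WeylGL.unit_last_last, ops_levi_one_tmul, ops_euler_one_tmul, ops_raise_one_tmul, zero_smul,
    smul_zero, LinearMap.zero_apply, add_zero, Finset.sum_const_zero, TensorProduct.tmul_sum, TensorProduct.tmul_smul]
  rfl

variable (m V) in
/-- The action of `U(sl(m + 1))` on the polynomial model. -/
noncomputable def modelAlgHom : UniversalEnvelopingAlgebra ℂ (sl m) →ₐ[ℂ]
    Module.End ℂ (MvPolynomial (Fin m) ℂ ⊗[ℂ] V) :=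
  lift ℂ ((modelHom m V).comp (sl m).incl)

theorem modelAlgHom_ι (A : sl m) : modelAlgHom m V (ι ℂ A) =
    modelHom m V (A : Matrix (Fin (m + 1)) (Fin (m + 1)) ℂ) :=
  lift_ι_apply ℂ _ A

noncomputable instance : Module (UniversalEnvelopingAlgebra ℂ (sl m))
    (MvPolynomial (Fin m) ℂ ⊗[ℂ] V) :=
  Module.compHom _ (modelAlgHom m V).toRingHom

theorem model_smul (x : UniversalEnvelopingAlgebra ℂ (sl m)) (z : MvPolynomial (Fin m) ℂ ⊗[ℂ] V) :
    x • z = modelAlgHom m V x z := rfl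

instance : IsScalarTower ℂ (UniversalEnvelopingAlgebra ℂ (sl m)) (MvPolynomial (Fin m) ℂ ⊗[ℂ] V) :=
  ⟨fun c x z => by simp [model_smul]⟩

variable (m V) in
/-- The map from the generalized Verma module to the polynomial model. -/
noncomputable def toModel : GeneralizedVerma m V →ₗ[UniversalEnvelopingAlgebra ℂ (sl m)]
    MvPolynomial (Fin m) ℂ ⊗[ℂ] V :=
  (inducedRel ℂ (parabolic m) (Inflation m V)).liftQ
    (TensorProduct.AlgebraTensorModule.lift (LinearMap.toSpanSingleton
      (UniversalEnvelopingAlgebra ℂ (sl m)) _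
      (TensorProduct.mk ℂ (MvPolynomial (Fin m) ℂ) V 1 :
        Inflation m V →ₗ[ℂ] MvPolynomial (Fin m) ℂ ⊗[ℂ] V))) <| by
    refine Submodule.span_le.mpr ?_
    rintro _ ⟨x, k, w, rfl⟩
    rw [SetLike.mem_coe, LinearMap.mem_ker, map_sub, sub_eq_zero]
    let v : V := w
    change (x * ι ℂ (k : sl m)) • ((1 : MvPolynomial (Fin m) ℂ) ⊗ₜ[ℂ] v) =
      x • ((1 : MvPolynomial (Fin m) ℂ) ⊗ₜ[ℂ] ⁅leviProj m k, v⁆)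
    rw [mul_smul, model_smul (ι ℂ (k : sl m)), modelAlgHom_ι, ← modelHom_one_tmul]

variable (m V) in
/-- The inclusion `v ↦ 1 ⊗ v` of `V` into the generalized Verma module. -/
noncomputable def gen : V →ₗ[ℂ] GeneralizedVerma m V :=
  ((Induced.mk ℂ (parabolic m) (Inflation m V)).restrictScalars ℂ ∘ₗ
    TensorProduct.mk ℂ (UniversalEnvelopingAlgebra ℂ (sl m)) (Inflation m V) 1 :
    Inflation m V →ₗ[ℂ] GeneralizedVerma m V)

theorem toModel_smul_gen (x : UniversalEnvelopingAlgebra ℂ (sl m)) (v : V) :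
    toModel m V (x • gen m V v) = modelAlgHom m V x (1 ⊗ₜ v) := by
  rw [map_smul]
  change x • ((1 : UniversalEnvelopingAlgebra ℂ (sl m)) •
    ((1 : MvPolynomial (Fin m) ℂ) ⊗ₜ[ℂ] (v : V))) = _
  rw [one_smul, model_smul]

theorem lie_gen (k : parabolic m) (v : V) : ⁅(k : sl m), gen m V v⁆ = gen m V ⁅leviProj m k, v⁆ := by
  rw [lie_def]
  let w : Inflation m V := v
  change ι ℂ (k : sl m) • Induced.mk ℂ (parabolic m) (Inflation m V) (1 ⊗ₜ w) =
    Induced.mk ℂ (parabolic m) (Inflation m V) (1 ⊗ₜ ⁅k, w⁆)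
  rw [← map_smul, ← sub_eq_zero, ← map_sub]
  refine (Submodule.Quotient.mk_eq_zero _).mpr (Submodule.subset_span ⟨1, k, w, ?_⟩)
  rw [TensorProduct.smul_tmul', smul_eq_mul, mul_one, one_mul]

theorem toModel_lie (A : sl m) (z : GeneralizedVerma m V) :
    toModel m V ⁅A, z⁆ = ⁅A, toModel m V z⁆ := by
  rw [lie_def, map_smul, model_smul, modelAlgHom_ι, model_lie]

/-- A subspace stable under a Lie algebra is stable under its universal enveloping algebra. -/
theorem smul_mem_of_lie_mem {L M : Type*} [LieRing L] [LieAlgebra ℂ L] [AddCommGroup M] [Module ℂ M]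
    [Module (UniversalEnvelopingAlgebra ℂ L) M] [IsScalarTower ℂ (UniversalEnvelopingAlgebra ℂ L) M]
    (K : Submodule ℂ M) (hK : ∀ A : L, ∀ z ∈ K, ι ℂ A • z ∈ K)
    (x : UniversalEnvelopingAlgebra ℂ L) {z : M} (hz : z ∈ K) : x • z ∈ K := by
  -- The elements preserving `K` form a subalgebra containing `L`; the universal property gives a
  -- retraction onto it, so it is everything.
  let S : Subalgebra ℂ (UniversalEnvelopingAlgebra ℂ L) :=
    { carrier := {x | ∀ z ∈ K, x • z ∈ K}
      mul_mem' := fun ha hb z hz => by rw [mul_smul]; exact ha _ (hb z hz)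
      add_mem' := fun ha hb z hz => by rw [add_smul]; exact K.add_mem (ha z hz) (hb z hz)
      algebraMap_mem' := fun c z hz => by rw [algebraMap_smul]; exact K.smul_mem c hz }
  let f : L →ₗ⁅ℂ⁆ S :=
    { toFun := fun A => ⟨ι ℂ A, hK A⟩
      map_add' := fun A B => Subtype.ext (map_add _ A B)
      map_smul' := fun c A => Subtype.ext (map_smul _ c A)
      map_lie' := fun {A B} => Subtype.ext (LieHom.map_lie _ A B) }
  have h : S.val.comp (lift ℂ f) = AlgHom.id ℂ _ := by
    refine hom_ext ℂ (LieHom.ext fun A => ?_)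
    change ((lift ℂ f (ι ℂ A) : S) : UniversalEnvelopingAlgebra ℂ L) = ι ℂ A
    rw [lift_ι_apply]
    rfl
  have hx : ((lift ℂ f x : S) : UniversalEnvelopingAlgebra ℂ L) = x := DFunLike.congr_fun h x
  rw [← hx]
  exact (lift ℂ f x).2 z hz

theorem span_range_gen (K : Submodule ℂ (GeneralizedVerma m V))
    (hK : ∀ A : sl m, ∀ z ∈ K, ⁅A, z⁆ ∈ K) (h : LinearMap.range (gen m V) ≤ K) : K = ⊤ := by
  refine eq_top_iff.mpr ?_
  rintro z -
  obtain ⟨z, rfl⟩ := Submodule.Quotient.mk_surjective _ z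
  change Induced.mk ℂ (parabolic m) (Inflation m V) z ∈ K
  induction z using TensorProduct.induction_on with
  | zero => simp
  | tmul x w =>
    have hx : x ⊗ₜ[ℂ] w = x • ((1 : UniversalEnvelopingAlgebra ℂ (sl m)) ⊗ₜ[ℂ] w) := by
      rw [TensorProduct.smul_tmul', smul_eq_mul, mul_one]
    rw [hx, map_smul]
    exact smul_mem_of_lie_mem K hK x (h ⟨w, rfl⟩)
  | add a b ha hb => rw [map_add]; exact K.add_mem ha hb

/-- The root vectors of the opposite nilradical. -/
noncomputable abbrev lowering (m : ℕ) (t : Fin m) : sl m :=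
  LieAlgebra.SpecialLinear.single (Fin.last m) t.castSucc (Fin.castSucc_ne_last t).symm 1

theorem span_parabolic_union_lowering (m : ℕ) :
    Submodule.span ℂ ({A : sl m | A ∈ parabolic m} ∪ Set.range (lowering m)) = ⊤ := by
  refine eq_top_iff.mpr fun A _ => ?_
  set B : sl m := ∑ t : Fin m,
    (A : Matrix (Fin (m + 1)) (Fin (m + 1)) ℂ) (Fin.last m) t.castSucc • lowering m t with hB
  rw [← sub_add_cancel A B]
  refine Submodule.add_mem _ (Submodule.subset_span (Or.inl fun j => ?_))
    (Submodule.sum_mem _ fun t _ => Submodule.smul_mem _ _ (Submodule.subset_span (Or.inr ⟨t, rfl⟩)))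
  simp [hB, Matrix.sum_apply, Matrix.single_apply]

theorem lowering_lie_lowering (s t : Fin m) : ⁅lowering m s, lowering m t⁆ = 0 := by
  apply Subtype.ext
  rw [LieAlgebra.SpecialLinear.sl_bracket]
  simp [Fin.castSucc_ne_last]

variable (m V) in
-- The Poincaré–Birkhoff–Witt theorem is avoided: the commuting root vectors of the opposite
-- nilradical define a map `Ψ` from polynomials tensor `V` back to the induced module. It is a right
-- inverse of `toModel`, and it is surjective, so `toModel` is injective as well.
theorem toModel_bijective : Function.Bijective (toModel m V) := by
  obtain ⟨θ, hθ⟩ := exists_algHom_of_commute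
    (fun t => ι ℂ (lowering m t)) (fun s t => by
      rw [mul_eq_add_bracket, ← LieHom.map_lie, lowering_lie_lowering, map_zero, add_zero])
  let Ψ : MvPolynomial (Fin m) ℂ ⊗[ℂ] V →ₗ[ℂ] GeneralizedVerma m V :=
    TensorProduct.lift (LinearMap.mk₂ ℂ
      (fun P v => θ P • gen m V v)
      (fun P Q v => by rw [map_add, add_smul])
      (fun c P v => by rw [map_smul, smul_assoc])
      (fun P v w => by rw [map_add, smul_add])
      (fun c P v => by rw [map_smul, smul_comm]))
  have hΨ (P : MvPolynomial (Fin m) ℂ) (v : V) : Ψ (P ⊗ₜ v) = θ P • gen m V v := rfl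
  have hθ' : (modelAlgHom m V).comp θ = (Module.End.rTensorAlgHom ℂ _ V).comp
      (Algebra.lmul ℂ (MvPolynomial (Fin m) ℂ)) := by
    refine algHom_ext fun t => ?_
    rw [AlgHom.comp_apply, hθ, modelAlgHom_ι, LieAlgebra.SpecialLinear.val_single,
      modelHom_single, WeylGL.unit_last_castSucc]
    rfl
  have hcomp (z) : toModel m V (Ψ z) = z := by
    induction z using TensorProduct.induction_on with
    | zero => simp
    | tmul P v =>
      rw [hΨ, toModel_smul_gen, ← AlgHom.comp_apply, hθ']
      change (P * 1) ⊗ₜ v = _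
      rw [mul_one]
    | add a b ha hb => rw [map_add, map_add, ha, hb]
  -- The range of `Ψ` contains the `p`-stable generating space and is stable under the opposite
  -- nilradical, on which `Ψ` intertwines multiplication by `y_t`.
  have hsurj : LinearMap.range Ψ = ⊤ := by
    have key := lieSpan_le_of_span_union_eq_top (span_parabolic_union_lowering m)
      (U := LinearMap.range (gen m V)) (K := LinearMap.range Ψ) ?_ ?_ ?_
    · refine top_le_iff.mp ((span_range_gen _ (fun A z hz => ?_) ?_).ge.trans key)
      · exact LieSubmodule.lie_mem _ hz
      · exact LieSubmodule.subset_lieSpan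
    · rintro k hk _ ⟨v, rfl⟩
      exact ⟨_, (lie_gen ⟨k, hk⟩ v).symm⟩
    · rintro _ ⟨v, rfl⟩
      exact ⟨1 ⊗ₜ v, by rw [hΨ, map_one, one_smul]⟩
    · rintro _ ⟨t, rfl⟩ _ ⟨z, rfl⟩
      refine ⟨(ops m V).y t z, ?_⟩
      induction z using TensorProduct.induction_on with
      | zero => simp
      | tmul P v => rw [ops_y_tmul, hΨ, hΨ, lie_def, ← mul_smul, map_mul, hθ]
      | add a b ha hb => simp only [map_add, lie_add, ha, hb]
  have hΨs : Function.Surjective Ψ := LinearMap.range_eq_top.mp hsurj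
  refine ⟨fun x y hxy => ?_, fun z => ⟨Ψ z, hcomp z⟩⟩
  obtain ⟨x, rfl⟩ := hΨs x
  obtain ⟨y, rfl⟩ := hΨs y
  rw [hcomp, hcomp] at hxy
  rw [hxy]

variable (m V) in
/-- The generalized Verma module is isomorphic to the polynomial model. -/
noncomputable def modelEquiv :
    GeneralizedVerma m V ≃ₗ⁅ℂ, sl m⁆ MvPolynomial (Fin m) ℂ ⊗[ℂ] V :=
  { LinearEquiv.ofBijective ((toModel m V).restrictScalars ℂ) (toModel_bijective m V) with
    map_lie' := fun {A z} => toModel_lie A z }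

variable (m V) in
theorem isIrreducible_generalizedVerma_iff :
    LieModule.IsIrreducible ℂ (sl m) (GeneralizedVerma m V) ↔
      LieModule.IsIrreducible ℂ (sl m) (MvPolynomial (Fin m) ℂ ⊗[ℂ] V) :=
  (LieSubmodule.orderIsoMapComap (modelEquiv m V)).isSimpleOrder_iff

end Comparison

end GVM

namespace GVM

/-! ### Simple highest weight modules of `gl(m)` -/

section HighestWeight

variable {m : ℕ} {V : Type*} [AddCommGroup V] [Module ℂ V]
  [LieRingModule (gl m) V] [LieModule ℂ (gl m) V]

/-- The matrix units of `gl(m)`. -/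
abbrev eij (s t : Fin m) : gl m := Matrix.single s t 1

theorem eij_lie_eij_lie (s t q r : Fin m) (u : V) : ⁅eij s t, ⁅eij q r, u⁆⁆ = ⁅eij q r, ⁅eij s t, u⁆⁆ +
    ((if t = q then ⁅eij s r, u⁆ else 0) - (if r = s then ⁅eij q t, u⁆ else 0)) := by
  have h : ⁅eij s t, eij q r⁆ = (if t = q then eij s r else 0) - (if r = s then eij q t else 0) :=
    bracket_single s t q r
  rw [leibniz_lie, add_comm, h, sub_lie]
  congr 2 <;> split_ifs <;> simp

theorem span_upper_union_lower : Submodule.span ℂ ({A : gl m | ∃ s t, s ≤ t ∧ A = eij s t} ∪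
    {A : gl m | ∃ s t, s < t ∧ A = eij t s}) = ⊤ := by
  refine eq_top_iff.mpr ?_
  rintro A -
  rw [Matrix.matrix_eq_sum_single A]
  refine Submodule.sum_mem _ fun s _ => Submodule.sum_mem _ fun t _ => ?_
  have h : Matrix.single s t (A s t) = A s t • eij s t := by simp [eij]
  rw [h]
  refine Submodule.smul_mem _ _ (Submodule.subset_span ?_)
  rcases le_or_gt s t with hst | hst
  · exact Or.inl ⟨s, t, hst, rfl⟩
  · exact Or.inr ⟨t, s, hst, rfl⟩

/-- A highest weight vector of a simple module generates it under the lower triangular matrices. -/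
theorem eq_top_of_highestWeightVector [LieModule.IsIrreducible ℂ (gl m) V] {u : V} {ν : Fin m → ℂ}
    (hu : u ≠ 0) (hn : ∀ s t : Fin m, s < t → ⁅eij s t, u⁆ = 0)
    (hν : ∀ s : Fin m, ⁅eij s s, u⁆ = ν s • u) {K : Submodule ℂ V} (huK : u ∈ K)
    (hK : ∀ s t : Fin m, s < t → ∀ x ∈ K, ⁅eij t s, x⁆ ∈ K) : K = ⊤ := by
  have key := lieSpan_le_of_span_union_eq_top (span_upper_union_lower (m := m))
    (U := Submodule.span ℂ {u}) (K := K) ?_ ?_ ?_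
  · rcases eq_bot_or_eq_top
      (LieSubmodule.lieSpan ℂ (gl m) (Submodule.span ℂ {u} : Set V)) with h | h
    · exact absurd ((LieSubmodule.lieSpan_eq_bot_iff ..).mp h u
        (Submodule.mem_span_singleton_self u)) hu
    · rw [h] at key
      exact top_le_iff.mp key
  · rintro _ ⟨s, t, hst, rfl⟩ x hx
    obtain ⟨c, rfl⟩ := Submodule.mem_span_singleton.mp hx
    rw [lie_smul]
    refine Submodule.smul_mem _ _ ?_
    rcases hst.lt_or_eq with h | rfl
    · rw [hn s t h]; exact Submodule.zero_mem _
    · rw [hν]; exact Submodule.smul_mem _ _ (Submodule.mem_span_singleton_self u)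
  · rwa [Submodule.span_singleton_le_iff_mem]
  · rintro _ ⟨s, t, hst, rfl⟩ x hx
    exact hK s t hst x hx

variable {μ : Fin m → ℂ} {v : V}

/-- A functional on a simple highest weight module that is `1` at the highest weight vector and
vanishes on the image of the strictly lower triangular matrices. -/
structure IsTopFunctional (μ : Fin m → ℂ) (v : V) (φ : V →ₗ[ℂ] ℂ) : Prop where
  irreducible : LieModule.IsIrreducible ℂ (gl m) V
  lie_of_lt : ∀ i j : Fin m, i < j → ⁅eij i j, v⁆ = 0
  lie_self : ∀ i : Fin m, ⁅eij i i, v⁆ = μ i • v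
  apply_top : φ v = 1
  apply_lower : ∀ s t : Fin m, s < t → ∀ u, φ ⁅eij t s, u⁆ = 0

theorem exists_isTopFunctional [LieModule.IsIrreducible ℂ (gl m) V] (hv : v ≠ 0)
    (hn : ∀ i j : Fin m, i < j → ⁅eij i j, v⁆ = 0)
    (hμ : ∀ i : Fin m, ⁅eij i i, v⁆ = μ i • v) :
    ∃ φ : V →ₗ[ℂ] ℂ, IsTopFunctional μ v φ := by
  -- A grading element: each `e_{t,s}` with `s < t` lowers its eigenvalue by the positive integer `t
  -- - s`. Hence the image of the lower triangular part lies in the sum of the eigenspaces for `h0 -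
  -- 1, h0 - 2, …`, which does not contain `v`.
  let H : Module.End ℂ V := LieModule.toEnd ℂ (gl m) V (∑ i : Fin m, (-(i : ℂ)) • eij i i)
  have hH (u : V) : H u = ∑ i : Fin m, (-(i : ℂ)) • ⁅eij i i, u⁆ := by
    simp only [H, LieModule.toEnd_apply_apply, sum_lie, smul_lie]
  have hlow (s t : Fin m) (u : V) :
      H ⁅eij t s, u⁆ = ⁅eij t s, H u⁆ - ((t : ℂ) - s) • ⁅eij t s, u⁆ := by
    simp only [hH, lie_sum, lie_smul]
    simp only [eij_lie_eij_lie _ _ t s, smul_add, smul_sub, smul_ite, smul_zero,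
      Finset.sum_add_distrib, Finset.sum_sub_distrib]
    simp [sub_smul]
    abel
  set h0 : ℂ := ∑ i : Fin m, (-(i : ℂ)) * μ i with hh0
  have hHv : H v = h0 • v := by
    rw [hH, hh0, Finset.sum_smul]
    simp only [hμ, smul_smul]
  set K1 : Submodule ℂ V := ⨆ d : ℕ, H.eigenspace (h0 - (d + 1)) with hK1
  have hstep (s t : Fin m) (hst : s < t) (d : ℕ) (x : V) (hx : H x = (h0 - d) • x) :
      ⁅eij t s, x⁆ ∈ K1 := by
    obtain ⟨k, hk⟩ : ∃ k : ℕ, (t : ℕ) = s + k + 1 := ⟨t - s - 1, by omega⟩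
    have hk' : (t : ℂ) = s + k + 1 := by exact_mod_cast hk
    refine Submodule.mem_iSup_of_mem (d + k) (Module.End.mem_eigenspace_iff.mpr ?_)
    rw [hlow, hx, lie_smul, ← sub_smul, hk']
    congr 1
    push_cast
    ring
  have hN (s t : Fin m) (hst : s < t) (x : V) (hx : x ∈ Submodule.span ℂ {v} ⊔ K1) :
      ⁅eij t s, x⁆ ∈ K1 := by
    obtain ⟨a, ha, b, hb, rfl⟩ := Submodule.mem_sup.mp hx
    obtain ⟨c, rfl⟩ := Submodule.mem_span_singleton.mp ha
    rw [lie_add, lie_smul]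
    refine K1.add_mem (K1.smul_mem _ (hstep s t hst 0 v (by simpa using hHv))) ?_
    have hle : K1 ≤ K1.comap (LieModule.toEnd ℂ (gl m) V (eij t s)) :=
      iSup_le fun d x hx => hstep s t hst (d + 1) x (by
        rw [Module.End.mem_eigenspace_iff.mp hx]; push_cast; rfl)
    exact hle hb
  have htop := eq_top_of_highestWeightVector hv hn hμ (K := Submodule.span ℂ {v} ⊔ K1)
    (Submodule.mem_sup_left (Submodule.mem_span_singleton_self v))
    (fun s t hst x hx => Submodule.mem_sup_right (hN s t hst x hx))
  have hvK1 : v ∉ K1 := by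
    intro h
    have hle : K1 ≤ ⨆ (c : ℂ) (_ : c ≠ h0), H.eigenspace c := by
      refine iSup_le fun d => ?_
      refine le_iSup₂_of_le (h0 - (d + 1)) ?_ le_rfl
      intro hd
      exact Nat.cast_add_one_ne_zero (R := ℂ) d (sub_eq_self.mp hd)
    exact hv (Submodule.disjoint_def.mp (Module.End.eigenspaces_iSupIndep H h0) v
      (Module.End.mem_eigenspace_iff.mpr hHv) (hle h))
  obtain ⟨f, hfv, hf⟩ := Submodule.exists_le_ker_of_notMem hvK1
  refine ⟨(f v)⁻¹ • f, inferInstance, hn, hμ, by simp [hfv], fun s t hst u => ?_⟩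
  have : f ⁅eij t s, u⁆ = 0 := hf (hN s t hst u (htop ▸ Submodule.mem_top))
  simp [this]

/-! ### The top functional, dual to the highest weight vector -/

namespace IsTopFunctional

variable {φ : V →ₗ[ℂ] ℂ} (hφ : IsTopFunctional μ v φ)
include hφ

theorem top_ne_zero : v ≠ 0 := by
  rintro rfl
  simpa using hφ.apply_top

/-- `V` is spanned by `v` and the image of the lower triangular part. Identities for `φ` are proved
below by testing on these two pieces. -/
theorem eq_zero_of_apply_lower {ψ : V →ₗ[ℂ] ℂ} (hv : ψ v = 0)
    (h : ∀ s t : Fin m, s < t → ∀ u, ψ ⁅eij t s, u⁆ = 0) (u : V) : ψ u = 0 := by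
  have := hφ.irreducible
  have htop := eq_top_of_highestWeightVector hφ.top_ne_zero hφ.lie_of_lt hφ.lie_self
    (K := LinearMap.ker ψ) hv (fun s t hst x _ => h s t hst x)
  exact (htop ▸ Submodule.mem_top : u ∈ LinearMap.ker ψ)

theorem apply_diag (s : Fin m) (u : V) : φ ⁅eij s s, u⁆ = μ s * φ u := by
  have h := hφ.eq_zero_of_apply_lower
    (ψ := φ ∘ₗ (LieModule.toEnd ℂ (gl m) V (eij s s) : V →ₗ[ℂ] V) - μ s • φ) ?_ ?_ u
  · simpa [sub_eq_zero] using h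
  · simp [hφ.lie_self]
  · intro q r hqr u
    have h1 := hφ.apply_lower q r hqr
    simp only [LinearMap.sub_apply, LinearMap.comp_apply, LieModule.toEnd_apply_apply,
      LinearMap.smul_apply, h1, eij_lie_eij_lie s s, map_add, map_sub, apply_ite φ, map_zero]
    split_ifs <;> simp_all

/-- The functional vanishes on the upper triangular matrices inside a block. -/
theorem apply_upper {s t : Fin m} (hst : s < t) (hμ : ∀ i, s ≤ i → i ≤ t → μ i = μ s) (u : V) :
    φ ⁅eij s t, u⁆ = 0 := by
  -- Commuting `e_{s,t}` past a lower matrix unit leaves a lower unit, a shorter upper unit in the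
  -- same block, or `e_{s,s} - e_{t,t}`, on which `φ` vanishes since `μ s = μ t`.
  induction hd : (t : ℕ) - s using Nat.strong_induction_on generalizing s t u with
  | _ d ih =>
    have h := hφ.eq_zero_of_apply_lower
      (ψ := φ ∘ₗ (LieModule.toEnd ℂ (gl m) V (eij s t) : V →ₗ[ℂ] V)) ?_ ?_ u
    · simpa using h
    · simp [hφ.lie_of_lt s t hst]
    · intro r q hrq u
      have h1 := hφ.apply_lower r q hrq
      simp only [LinearMap.comp_apply, LieModule.toEnd_apply_apply, eij_lie_eij_lie s t, map_add,
        map_sub, h1, zero_add, apply_ite φ, map_zero]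
      by_cases hq : t = q
      · subst hq
        by_cases hr : r = s
        · subst hr
          simp [hφ.apply_diag, hμ t hst.le le_rfl]
        · rcases lt_or_gt_of_ne hr with hr' | hr'
          · simp [hr, hφ.apply_lower r s hr']
          · have := ih ((r : ℕ) - s) (by omega) hr'
              (fun i h1 h2 => hμ i h1 (h2.trans hrq.le)) u rfl
            simp [hr, this]
      · by_cases hr : r = s
        · subst hr
          rcases lt_or_gt_of_ne hq with hq' | hq'
          · simp [hq, hφ.apply_lower t q hq']
          · have := ih ((t : ℕ) - q) (by omega) hq' (fun i h1 h2 => by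
              rw [hμ i (hrq.le.trans h1) h2, hμ q hrq.le hq'.le]) u rfl
            simp [hq, this]
        · simp [hq, hr]

/-- The highest weight vector is annihilated by the lower triangular matrices inside a block. -/
theorem lower_top {s t : Fin m} (hst : s < t) (hμ : ∀ i, s ≤ i → i ≤ t → μ i = μ s) :
    ⁅eij t s, v⁆ = 0 := by
  have := hφ.irreducible
  induction hd : (t : ℕ) - s using Nat.strong_induction_on generalizing s t with
  | _ d ih =>
    by_contra hne
    -- If nonzero, `e_{t,s} v` would itself be a highest weight vector and generate `V` under lower
    -- triangular matrices. But it lies in `ker φ`, which they preserve, and `φ v = 1`.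
    have htop := eq_top_of_highestWeightVector (K := LinearMap.ker φ)
      (ν := fun i => μ i + (if i = t then 1 else 0) - (if i = s then 1 else 0)) hne ?_ ?_
      (hφ.apply_lower s t hst v) (fun q r hqr x _ => hφ.apply_lower q r hqr x)
    · have hv : v ∈ LinearMap.ker φ := htop ▸ Submodule.mem_top
      rw [LinearMap.mem_ker, hφ.apply_top] at hv
      exact one_ne_zero hv
    · intro q r hqr
      rw [eij_lie_eij_lie, hφ.lie_of_lt q r hqr, lie_zero, zero_add]
      by_cases hr : r = t
      · subst hr
        by_cases hq : s = q
        · subst hq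
          simp [hφ.lie_self, hμ r hqr.le le_rfl]
        · rcases lt_or_gt_of_ne hq with hq' | hq'
          · have := ih ((q : ℕ) - s) (by omega) hq'
              (fun i h1 h2 => hμ i h1 (h2.trans hqr.le)) rfl
            simp [hq, this]
          · simp [hq, hφ.lie_of_lt q s hq']
      · by_cases hq : s = q
        · subst hq
          rcases lt_or_gt_of_ne hr with hr' | hr'
          · have := ih ((t : ℕ) - r) (by omega) hr' (fun i h1 h2 => by
              rw [hμ i (hqr.le.trans h1) h2, hμ r hqr.le hr'.le]) rfl
            simp [hr, this]
          · simp [hr, hφ.lie_of_lt t r hr']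
        · simp [hr, hq]
    · intro i
      rw [eij_lie_eij_lie, hφ.lie_self, lie_smul]
      by_cases h1 : i = t <;> by_cases h2 : i = s
      · omega
      · subst h1; simp [h2, Ne.symm h2, add_smul]
      · subst h2; simp [h1, add_smul, sub_eq_add_neg]
      · simp [h1, h2, Ne.symm h2]

theorem apply_pow_diag {s t : Fin m} (hst : s < t) (k : ℕ) (u : V) :
    φ ((LieModule.toEnd ℂ (gl m) V (eij s t) ^ k) ⁅eij s s - eij t t, u⁆) =
      (μ s - μ t - 2 * k) * φ ((LieModule.toEnd ℂ (gl m) V (eij s t) ^ k) u) := by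
  induction k generalizing u with
  | zero => simp [sub_lie, hφ.apply_diag]; ring
  | succ k ih =>
    have h : ⁅eij s t, ⁅eij s s - eij t t, u⁆⁆ =
        ⁅eij s s - eij t t, ⁅eij s t, u⁆⁆ - (2 : ℂ) • ⁅eij s t, u⁆ := by
      simp only [sub_lie, lie_sub, eij_lie_eij_lie s t]
      simp [hst.ne', two_smul]
      abel
    simp only [pow_succ, Module.End.mul_apply, LieModule.toEnd_apply_apply]
    rw [h, map_sub, map_sub, ih, map_smul, map_smul, smul_eq_mul]
    push_cast
    ring

/-- For the `sl(2)` triple of `(s, t)` the functional is a highest weight covector of weight `μ s -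
μ t`. This is the dual of the usual formula for `e f^(k+1)` on a highest weight vector. -/
theorem apply_pow_lower {s t : Fin m} (hst : s < t) (k : ℕ) (u : V) :
    φ ((LieModule.toEnd ℂ (gl m) V (eij s t) ^ (k + 1)) ⁅eij t s, u⁆) =
      (k + 1) * (μ s - μ t - k) * φ ((LieModule.toEnd ℂ (gl m) V (eij s t) ^ k) u) := by
  have h (u : V) : ⁅eij s t, ⁅eij t s, u⁆⁆ = ⁅eij t s, ⁅eij s t, u⁆⁆ + ⁅eij s s - eij t t, u⁆ := by
    rw [eij_lie_eij_lie s t]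
    simp [sub_lie]
  induction k generalizing u with
  | zero => simp [h, hφ.apply_lower s t hst, sub_lie, hφ.apply_diag, sub_mul]
  | succ k ih =>
    rw [pow_succ]
    simp only [Module.End.mul_apply, LieModule.toEnd_apply_apply]
    rw [h, map_add, map_add, ih, hφ.apply_pow_diag hst, pow_succ (n := k)]
    simp only [Module.End.mul_apply, LieModule.toEnd_apply_apply]
    push_cast
    ring

/-- If `μ_s - μ_{s+1}` is a natural number `n` then `e_{s,s+1}^{n+1}` maps into the kernel of the
functional. -/
theorem apply_pow_simple {s t : Fin m} (hst : (t : ℕ) = s + 1) {n : ℕ} (hn : μ s - μ t = n) (u : V) :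
    φ ((LieModule.toEnd ℂ (gl m) V (eij s t) ^ (n + 1)) u) = 0 := by
  have hlt : s < t := by omega
  refine hφ.eq_zero_of_apply_lower
    (ψ := φ ∘ₗ ((LieModule.toEnd ℂ (gl m) V (eij s t) : V →ₗ[ℂ] V) ^ (n + 1))) ?_ ?_ u
  · simp [pow_succ, hφ.lie_of_lt s t hlt]
  · intro r q hrq u
    rw [LinearMap.comp_apply]
    by_cases hqr : t = q ∧ r = s
    · obtain ⟨rfl, rfl⟩ := hqr
      rw [hφ.apply_pow_lower hlt, hn]
      simp
    · have key (k : ℕ) (u : V) :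
          φ ((LieModule.toEnd ℂ (gl m) V (eij s t) ^ k) ⁅eij q r, u⁆) = 0 := by
        induction k generalizing u with
        | zero => simpa using hφ.apply_lower r q hrq u
        | succ k ih =>
          have hcomm (a b : Fin m) (h1 : t ≠ a) (h2 : b ≠ s) :
              φ ((LieModule.toEnd ℂ (gl m) V (eij s t) ^ k) ⁅eij a b, u⁆) =
                φ ⁅eij a b, (LieModule.toEnd ℂ (gl m) V (eij s t) ^ k) u⁆ := by
            have h : Commute (LieModule.toEnd ℂ (gl m) V (eij s t))
                (LieModule.toEnd ℂ (gl m) V (eij a b)) :=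
              LinearMap.ext fun x => by
                simpa [h1, h2] using eij_lie_eij_lie s t a b x
            exact congrArg φ (LinearMap.congr_fun (h.pow_left k) u)
          rw [pow_succ]
          simp only [Module.End.mul_apply, LieModule.toEnd_apply_apply]
          rw [eij_lie_eij_lie s t, map_add, map_add, ih, zero_add]
          by_cases hq : t = q
          · have hr : r ≠ s := fun h => hqr ⟨hq, h⟩
            rw [if_pos hq, if_neg hr, sub_zero, hcomm s r hlt.ne' hr,
              hφ.apply_lower r s (by omega)]
          · by_cases hr : r = s
            · rw [if_neg hq, if_pos hr, zero_sub, map_neg, map_neg, hcomm q t hq hlt.ne',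
                hφ.apply_lower t q (by omega), neg_zero]
            · simp [hq, hr]
      exact key _ _

end IsTopFunctional

end HighestWeight

end GVM

namespace GVM

/-! ### Singular vectors in the polynomial model -/

section Singular

open MvPolynomial

theorem coeff_X_mul_pderiv {σ : Type*} (t : σ) (P : MvPolynomial σ ℂ) (α : σ →₀ ℕ) :
    coeff α (X t * pderiv t P) = α t * coeff α P := by
  classical
  rw [coeff_X_mul']
  split_ifs with h
  · rw [coeff_pderiv, Finsupp.mem_support_iff] at *
    have h1 : Finsupp.single t 1 ≤ α := by
      rw [Finsupp.single_le_iff]; omega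
    have h2 : (((α - Finsupp.single t 1 : σ →₀ ℕ) t : ℕ) : ℂ) + 1 = α t := by
      rw [Finsupp.tsub_apply, Finsupp.single_eq_same]
      exact_mod_cast Nat.sub_add_cancel (Nat.one_le_iff_ne_zero.mpr h)
    rw [tsub_add_cancel_of_le h1, h2, mul_comm]
  · rw [Finsupp.notMem_support_iff.mp h]; simp

variable {m : ℕ} {V : Type*} [AddCommGroup V] [Module ℂ V]

/-- The coefficient of a monomial in `ℂ[y_1, …, y_m] ⊗ V`. -/
noncomputable def tcoeff (α : Fin m →₀ ℕ) : MvPolynomial (Fin m) ℂ ⊗[ℂ] V →ₗ[ℂ] V :=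
  TensorProduct.lid ℂ V ∘ₗ (lcoeff ℂ α).rTensor V

@[simp] theorem tcoeff_tmul (α : Fin m →₀ ℕ) (P : MvPolynomial (Fin m) ℂ) (v : V) :
    tcoeff α (P ⊗ₜ v) = coeff α P • v := rfl

theorem eq_zero_of_tcoeff {z : MvPolynomial (Fin m) ℂ ⊗[ℂ] V} (h : ∀ α, tcoeff α z = 0) :
    z = 0 := by
  refine (TensorProduct.equivFinsuppOfBasisLeft (basisMonomials (Fin m) ℂ)).injective ?_
  rw [map_zero]
  ext α
  rw [TensorProduct.equivFinsuppOfBasisLeft_apply]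
  exact h α

/-- Contraction of `ℂ[y_1, …, y_m] ⊗ V` with a functional on `V`. -/
noncomputable def contract (ψ : V →ₗ[ℂ] ℂ) :
    MvPolynomial (Fin m) ℂ ⊗[ℂ] V →ₗ[ℂ] MvPolynomial (Fin m) ℂ :=
  (TensorProduct.rid ℂ (MvPolynomial (Fin m) ℂ)).toLinearMap ∘ₗ
    ψ.lTensor (MvPolynomial (Fin m) ℂ)

@[simp] theorem contract_tmul (ψ : V →ₗ[ℂ] ℂ) (P : MvPolynomial (Fin m) ℂ) (v : V) :
    contract ψ (P ⊗ₜ v) = ψ v • P := rfl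

theorem coeff_contract (ψ : V →ₗ[ℂ] ℂ) (α : Fin m →₀ ℕ) (z : MvPolynomial (Fin m) ℂ ⊗[ℂ] V) :
    coeff α (contract ψ z) = ψ (tcoeff α z) := by
  induction z using TensorProduct.induction_on with
  | zero => simp
  | tmul P v => simp [mul_comm]
  | add a b ha hb => simp [ha, hb]

theorem exists_degree_bound (z : MvPolynomial (Fin m) ℂ ⊗[ℂ] V) :
    ∃ d : ℕ, ∀ α : Fin m →₀ ℕ, d ≤ α.degree → tcoeff α z = 0 := by
  induction z using TensorProduct.induction_on with
  | zero => exact ⟨0, by simp⟩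
  | tmul P v =>
    refine ⟨P.totalDegree + 1, fun α hα => ?_⟩
    rw [tcoeff_tmul, coeff_eq_zero_of_totalDegree_lt, zero_smul]
    rw [← Finsupp.degree_apply]
    omega
  | add a b ha hb =>
    obtain ⟨c, hc⟩ := ha
    obtain ⟨d, hd⟩ := hb
    exact ⟨max c d, fun α hα => by
      rw [map_add, hc α (le_of_max_le_left hα), hd α (le_of_max_le_right hα), add_zero]⟩

variable [LieRingModule (gl m) V] [LieModule ℂ (gl m) V]

theorem tcoeff_euler (α : Fin m →₀ ℕ) (z : MvPolynomial (Fin m) ℂ ⊗[ℂ] V) :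
    tcoeff α ((ops m V).euler z) = (α.degree : ℂ) • tcoeff α z := by
  induction z using TensorProduct.induction_on with
  | zero => simp
  | tmul P v =>
    simp only [WeylGL.euler, LinearMap.sum_apply, Module.End.mul_apply, ops_d_tmul, ops_y_tmul,
      map_sum, tcoeff_tmul, coeff_X_mul_pderiv, Finsupp.degree_eq_sum, Nat.cast_sum, Finset.sum_smul,
      mul_smul]
  | add a b ha hb => simp only [map_add, ha, hb, smul_add]

theorem tcoeff_eq_zero_of_euler {c : ℂ} {z : MvPolynomial (Fin m) ℂ ⊗[ℂ] V}
    (hz : (ops m V).euler z = c • z) {α : Fin m →₀ ℕ} (hα : (α.degree : ℂ) ≠ c) :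
    tcoeff α z = 0 := by
  have h := tcoeff_euler α z
  rw [hz, map_smul, ← sub_eq_zero, ← sub_smul] at h
  exact (smul_eq_zero.mp h).resolve_left (sub_ne_zero.mpr hα.symm)

theorem contract_y (ψ : V →ₗ[ℂ] ℂ) (s : Fin m) (z : MvPolynomial (Fin m) ℂ ⊗[ℂ] V) :
    contract ψ ((ops m V).y s z) = X s * contract ψ z := by
  induction z using TensorProduct.induction_on with
  | zero => simp
  | tmul P v => simp
  | add a b ha hb => simp [ha, hb, mul_add]

theorem contract_d (ψ : V →ₗ[ℂ] ℂ) (s : Fin m) (z : MvPolynomial (Fin m) ℂ ⊗[ℂ] V) :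
    contract ψ ((ops m V).d s z) = pderiv s (contract ψ z) := by
  induction z using TensorProduct.induction_on with
  | zero => simp
  | tmul P v => simp
  | add a b ha hb => simp [ha, hb]

theorem contract_e (ψ : V →ₗ[ℂ] ℂ) (s t : Fin m) (z : MvPolynomial (Fin m) ℂ ⊗[ℂ] V) :
    contract ψ ((ops m V).e s t z) =
      contract (ψ ∘ₗ (LieModule.toEnd ℂ (gl m) V (eij s t) : V →ₗ[ℂ] V)) z := by
  induction z using TensorProduct.induction_on with
  | zero => simp
  | tmul P v => simp
  | add a b ha hb => simp [ha, hb]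

theorem contract_levi (ψ : V →ₗ[ℂ] ℂ) (s t : Fin m) (z : MvPolynomial (Fin m) ℂ ⊗[ℂ] V) :
    contract ψ ((ops m V).levi s t z) =
      contract (ψ ∘ₗ (LieModule.toEnd ℂ (gl m) V (eij s t) : V →ₗ[ℂ] V)) z -
        X t * pderiv s (contract ψ z) := by
  rw [WeylGL.levi, LinearMap.sub_apply, Module.End.mul_apply, map_sub, contract_e, contract_y,
    contract_d]

theorem contract_congr {ψ ψ' : V →ₗ[ℂ] ℂ} (h : ∀ u, ψ u = ψ' u)
    (z : MvPolynomial (Fin m) ℂ ⊗[ℂ] V) : contract ψ z = contract ψ' z := by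
  rw [LinearMap.ext h]

theorem contract_smul (c : ℂ) (ψ : V →ₗ[ℂ] ℂ) (z : MvPolynomial (Fin m) ℂ ⊗[ℂ] V) :
    contract (c • ψ) z = c • contract ψ z := by
  ext α
  simp [coeff_contract]

theorem contract_zero (z : MvPolynomial (Fin m) ℂ ⊗[ℂ] V) :
    contract (0 : V →ₗ[ℂ] ℂ) z = 0 := by
  ext α
  simp [coeff_contract]

variable (m V) in
/-- The vectors of degree `k` in the polynomial model that are annihilated by the nilradical. -/
def singular (k : ℕ) : Submodule ℂ (MvPolynomial (Fin m) ℂ ⊗[ℂ] V) where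
  carrier := {z | (ops m V).euler z = (k : ℂ) • z ∧ ∀ s, (ops m V).raise s z = 0}
  zero_mem' := by simp
  add_mem' := fun ha hb => ⟨by rw [map_add, ha.1, hb.1, smul_add],
    fun s => by rw [map_add, ha.2, hb.2, add_zero]⟩
  smul_mem' := fun c z hz => ⟨by rw [map_smul, hz.1, smul_comm],
    fun s => by rw [map_smul, hz.2, smul_zero]⟩

theorem apply_apply_eq {M : Type*} [AddCommGroup M] [Module ℂ M] (f g : Module.End ℂ M) (z : M) :
    f (g z) = g (f z) + ⁅f, g⁆ z :=
  LinearMap.congr_fun (mul_eq_add_bracket f g) z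

/-- Bracketing a Levi element with the nilradical stays in the nilradical, and Levi elements
preserve degree. -/
theorem levi_mem_singular {k : ℕ} {z : MvPolynomial (Fin m) ℂ ⊗[ℂ] V} (hz : z ∈ singular m V k)
    (s t : Fin m) : (ops m V).levi s t z ∈ singular m V k := by
  refine ⟨?_, fun r => ?_⟩
  · rw [apply_apply_eq, WeylGL.euler_levi, hz.1, map_smul, LinearMap.zero_apply, add_zero]
  · rw [apply_apply_eq, hz.2, map_zero, ← lie_skew, WeylGL.levi_raise]
    split_ifs <;> simp [hz.2]

theorem parabolic_lie_mem_singular {k : ℕ} {z : MvPolynomial (Fin m) ℂ ⊗[ℂ] V}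
    (hz : z ∈ singular m V k) {A : sl m} (hA : A ∈ parabolic m) : ⁅A, z⁆ ∈ singular m V k := by
  have hA' : ∀ j : Fin m,
    (A : Matrix (Fin (m + 1)) (Fin (m + 1)) ℂ) (Fin.last m) j.castSucc = 0 := hA
  rw [model_lie, modelHom_apply]
  simp only [Fin.sum_univ_castSucc, hA', LinearMap.add_apply, LinearMap.sum_apply,
    LinearMap.smul_apply, WeylGL.unit_castSucc_castSucc, WeylGL.unit_castSucc_last,
    WeylGL.unit_last_last, zero_smul, Finset.sum_const_zero, zero_add, hz.1,
    hz.2, smul_zero, add_zero]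
  exact Submodule.add_mem _ (Submodule.sum_mem _ fun s _ => Submodule.sum_mem _ fun t _ =>
    Submodule.smul_mem _ _ (levi_mem_singular hz s t))
    (Submodule.smul_mem _ _ (Submodule.smul_mem _ _ hz))

/-- A singular vector of positive degree generates a proper submodule. -/
theorem not_isIrreducible_of_singular [Nontrivial V] {k : ℕ} (hk : 0 < k)
    {w : MvPolynomial (Fin m) ℂ ⊗[ℂ] V} (hw : w ∈ singular m V k) (hw0 : w ≠ 0) :
    ¬ LieModule.IsIrreducible ℂ (sl m) (MvPolynomial (Fin m) ℂ ⊗[ℂ] V) := by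
  intro h
  -- The singular space is `p`-stable and the opposite nilradical multiplies by variables, so
  -- nothing generated from it has a constant term, whereas `1 ⊗ v` does.
  have key := lieSpan_le_of_span_union_eq_top (span_parabolic_union_lowering m)
    (U := singular m V k) (K := LinearMap.ker (tcoeff (V := V) (0 : Fin m →₀ ℕ)))
    (fun A hA x hx => parabolic_lie_mem_singular hx hA)
    (fun x hx => tcoeff_eq_zero_of_euler hx.1 (by simpa [eq_comm] using hk.ne')) ?_
  · rcases eq_bot_or_eq_top (LieSubmodule.lieSpan ℂ (sl m)
      (singular m V k : Set (MvPolynomial (Fin m) ℂ ⊗[ℂ] V))) with h | h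
    · exact hw0 ((LieSubmodule.lieSpan_eq_bot_iff ..).mp h w hw)
    · rw [h] at key
      obtain ⟨v, hv⟩ := exists_ne (0 : V)
      have : (1 : MvPolynomial (Fin m) ℂ) ⊗ₜ[ℂ] v ∈
        LinearMap.ker (tcoeff (V := V) (0 : Fin m →₀ ℕ)) := key Submodule.mem_top
      simp [hv] at this
  · rintro _ ⟨t, rfl⟩ z -
    rw [model_lie, LieAlgebra.SpecialLinear.val_single, modelHom_single,
      WeylGL.unit_last_castSucc, LinearMap.mem_ker]
    induction z using TensorProduct.induction_on with
    | zero => simp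
    | tmul P v => simp [coeff_X_mul']
    | add a b ha hb => simp [ha, hb]

/-- The identity matrix acts on a simple highest weight module by a scalar. -/
theorem IsTopFunctional.exists_scalar {μ : Fin m → ℂ} {v : V} {φ : V →ₗ[ℂ] ℂ}
    (hφ : IsTopFunctional μ v φ) (u : V) : ∑ s : Fin m, ⁅eij s s, u⁆ = (∑ s, μ s) • u := by
  have := hφ.irreducible
  have htop := eq_top_of_highestWeightVector hφ.top_ne_zero hφ.lie_of_lt hφ.lie_self
    (K := LinearMap.ker ((∑ s, LieModule.toEnd ℂ (gl m) V (eij s s) : V →ₗ[ℂ] V) -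
      (∑ s, μ s) • LinearMap.id)) ?_ ?_
  · have hu : u ∈ LinearMap.ker ((∑ s, LieModule.toEnd ℂ (gl m) V (eij s s) : V →ₗ[ℂ] V) -
      (∑ s, μ s) • LinearMap.id) := htop ▸ Submodule.mem_top
    simpa [sub_eq_zero] using hu
  · simp [hφ.lie_self, Finset.sum_smul]
  · intro s t hst x hx
    simp only [LinearMap.mem_ker, LinearMap.sub_apply, LinearMap.sum_apply,
      LieModule.toEnd_apply_apply, LinearMap.smul_apply, LinearMap.id_apply, sub_eq_zero] at hx ⊢
    simp only [eij_lie_eij_lie _ _ t s, Finset.sum_add_distrib, Finset.sum_sub_distrib]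
    rw [← lie_sum, hx]
    simp

/-- A Lie submodule of the polynomial model is stable under `gl(m + 1)`. -/
theorem IsTopFunctional.modelHom_mem {μ : Fin m → ℂ} {v : V} {φ : V →ₗ[ℂ] ℂ}
    (hφ : IsTopFunctional μ v φ) (N : LieSubmodule ℂ (sl m) (MvPolynomial (Fin m) ℂ ⊗[ℂ] V))
    {z : MvPolynomial (Fin m) ℂ ⊗[ℂ] V} (hz : z ∈ N) (A : Matrix (Fin (m + 1)) (Fin (m + 1)) ℂ) :
    modelHom m V A z ∈ N := by
  have h1 : modelHom m V 1 z = (∑ s, μ s) • z := by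
    have : modelHom m V 1 = ∑ s, (ops m V).e s s := by
      rw [modelHom_apply]
      simp only [Matrix.one_apply, ite_smul, one_smul, zero_smul, Finset.sum_ite_eq, Finset.mem_univ,
        if_true, Fin.sum_univ_castSucc, WeylGL.unit_castSucc_castSucc, WeylGL.unit_last_last]
      rw [WeylGL.euler, ← Finset.sum_add_distrib]
      simp [WeylGL.levi]
    rw [this, LinearMap.sum_apply]
    clear hz
    induction z using TensorProduct.induction_on with
    | zero => simp
    | tmul P u =>
      simp only [ops_e_tmul, ← TensorProduct.tmul_sum, ← TensorProduct.tmul_smul]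
      rw [hφ.exists_scalar]
    | add a b ha hb => simp only [map_add, Finset.sum_add_distrib, ha, hb, smul_add]
  -- The trace part is split off because the identity acts by a scalar. This makes the Euler
  -- operator, which comes from `E_{m+1,m+1}` outside `sl(m + 1)`, available on submodules.
  set c : ℂ := A.trace / (m + 1) with hc
  have hm : (m : ℂ) + 1 ≠ 0 := Nat.cast_add_one_ne_zero m
  have hA : A - c • 1 ∈ sl m := by
    change Matrix.trace (A - c • (1 : Matrix (Fin (m + 1)) (Fin (m + 1)) ℂ)) = 0
    simp [Matrix.trace_sub, Matrix.trace_smul, hc]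
    field_simp
    simp
  have hAz : modelHom m V A z = ⁅(⟨A - c • 1, hA⟩ : sl m), z⁆ + c • (∑ s, μ s) • z := by
    rw [model_lie, map_sub, map_smul, LinearMap.sub_apply, LinearMap.smul_apply, h1]
    abel
  rw [hAz]
  exact N.add_mem (N.lie_mem hz) (N.smul_mem _ (N.smul_mem _ hz))

/-- In a nonzero submodule, a nonzero element of least degree is homogeneous and killed by `raise`,
since otherwise one of lower degree would exist. If that degree is `0`, simplicity of `V` puts all
of `1 ⊗ V`, hence everything, in the submodule. -/
theorem IsTopFunctional.exists_singular {μ : Fin m → ℂ} {v : V} {φ : V →ₗ[ℂ] ℂ}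
    (hφ : IsTopFunctional μ v φ)
    (h : ¬ LieModule.IsIrreducible ℂ (sl m) (MvPolynomial (Fin m) ℂ ⊗[ℂ] V)) :
    ∃ k : ℕ, 0 < k ∧ singular m V k ≠ ⊥ := by
  have := hφ.irreducible
  have : Nontrivial (MvPolynomial (Fin m) ℂ ⊗[ℂ] V) := by
    refine ⟨1 ⊗ₜ v, 0, fun h => hφ.top_ne_zero ?_⟩
    simpa using congrArg (tcoeff (0 : Fin m →₀ ℕ)) h
  by_contra! hsing
  refine h (LieModule.IsIrreducible.mk fun N hN => ?_)
  have hU (a b : Fin (m + 1)) {z} (hz : z ∈ N) : (ops m V).unit a b z ∈ N := by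
    rw [← modelHom_single]; exact hφ.modelHom_mem N hz _
  have hE {z} (hz : z ∈ N) : (ops m V).euler z ∈ N := by
    simpa using hU (Fin.last m) (Fin.last m) hz
  -- Here `d` strictly bounds the degrees, so after `d = k + 1` below the top degree is `k`.
  have hex : ∃ d : ℕ, ∃ z ∈ N, z ≠ 0 ∧ ∀ α : Fin m →₀ ℕ, d ≤ α.degree → tcoeff α z = 0 := by
    obtain ⟨z, hz, hz0⟩ : ∃ z ∈ N, z ≠ 0 := by
      by_contra! h
      exact hN ((LieSubmodule.eq_bot_iff N).mpr h)
    obtain ⟨d, hd⟩ := exists_degree_bound z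
    exact ⟨d, z, hz, hz0, hd⟩
  classical
  obtain ⟨z, hz, hz0, hd⟩ := Nat.find_spec hex
  have hmin := fun k => Nat.find_min hex (m := k)
  generalize Nat.find hex = d at *
  obtain _ | k := d
  · exact absurd (eq_zero_of_tcoeff fun α => hd α (Nat.zero_le _)) hz0
  have hmin' {x} (hx : x ∈ N) (h : ∀ α : Fin m →₀ ℕ, k ≤ α.degree → tcoeff α x = 0) : x = 0 := by
    by_contra hx0
    exact hmin k (Nat.lt_succ_self k) ⟨x, hx, hx0, h⟩
  have heuler : (ops m V).euler z = (k : ℂ) • z := by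
    rw [← sub_eq_zero]
    refine hmin' (N.sub_mem (hE hz) (N.smul_mem _ hz)) fun α hα => ?_
    rw [map_sub, tcoeff_euler, map_smul, ← sub_smul]
    rcases hα.eq_or_lt with h | h
    · rw [h, sub_self, zero_smul]
    · rw [hd α h, smul_zero]
  have hraise (s : Fin m) : (ops m V).raise s z = 0 := by
    refine hmin' (by simpa using hU s.castSucc (Fin.last m) hz) fun α hα => ?_
    refine tcoeff_eq_zero_of_euler (c := k - 1) ?_ fun h => ?_
    · rw [apply_apply_eq, heuler, WeylGL.euler_raise, map_smul, LinearMap.neg_apply]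
      module
    · rw [eq_sub_iff_add_eq] at h
      have : α.degree + 1 = k := by exact_mod_cast h
      omega
  obtain _ | k := k
  · have hz1 : z = 1 ⊗ₜ tcoeff 0 z := by
      rw [← sub_eq_zero]
      refine eq_zero_of_tcoeff fun α => ?_
      rcases eq_or_ne α 0 with rfl | hα
      · simp
      · rw [map_sub, hd α (Nat.one_le_iff_ne_zero.mpr
          ((Finsupp.degree_eq_zero_iff α).not.mpr hα)), tcoeff_tmul,
          coeff_one, if_neg hα.symm, zero_smul, sub_zero]
    let K : LieSubmodule ℂ (gl m) V :=
      { N.toSubmodule.comap (TensorProduct.mk ℂ (MvPolynomial (Fin m) ℂ) V 1) with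
        lie_mem := fun {A u} hu => by
          change (1 : MvPolynomial (Fin m) ℂ) ⊗ₜ[ℂ] ⁅A, u⁆ ∈ N
          rw [← sum_lie_single, TensorProduct.tmul_sum]
          refine sum_mem fun s _ => ?_
          rw [TensorProduct.tmul_sum]
          refine sum_mem fun t _ => ?_
          rw [TensorProduct.tmul_smul, ← ops_levi_one_tmul, ← WeylGL.unit_castSucc_castSucc]
          exact N.smul_mem _ (hU _ _ hu) }
    have hK : K = ⊤ := by
      refine (eq_bot_or_eq_top K).resolve_left fun h => hz0 ?_
      have hzK : tcoeff 0 z ∈ K := by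
        change (1 : MvPolynomial (Fin m) ℂ) ⊗ₜ[ℂ] tcoeff 0 z ∈ N
        rwa [← hz1]
      rw [h, LieSubmodule.mem_bot] at hzK
      rw [hz1, hzK, TensorProduct.tmul_zero]
    have hN (P : MvPolynomial (Fin m) ℂ) (u : V) : P ⊗ₜ[ℂ] u ∈ N := by
      induction P using MvPolynomial.induction_on with
      | C c =>
        have hu : (1 : MvPolynomial (Fin m) ℂ) ⊗ₜ[ℂ] u ∈ N := (hK ▸ LieSubmodule.mem_top u : u ∈ K)
        rw [C_eq_smul_one, ← TensorProduct.smul_tmul']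
        exact N.smul_mem c hu
      | add P Q hP hQ => rw [TensorProduct.add_tmul]; exact N.add_mem hP hQ
      | mul_X P t hP =>
        rw [mul_comm, ← ops_y_tmul, ← WeylGL.unit_last_castSucc]
        exact hU _ _ hP
    refine eq_top_iff.mpr ?_
    rintro x -
    induction x using TensorProduct.induction_on with
    | zero => exact N.zero_mem
    | tmul P u => exact hN P u
    | add a b ha hb => exact N.add_mem ha hb
  · exact absurd ((Submodule.eq_bot_iff _).mp (hsing (k + 1) k.succ_pos) z ⟨heuler, hraise⟩) hz0

end Singular

end GVM

namespace GVM

/-! ### Necessary conditions for reducibility -/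

section Necessary

open MvPolynomial

/-- Partial derivatives as linear endomorphisms. -/
noncomputable def pd {σ : Type*} (s : σ) : Module.End ℂ (MvPolynomial σ ℂ) :=
  (pderiv s : Derivation ℂ (MvPolynomial σ ℂ) (MvPolynomial σ ℂ)).toLinearMap

theorem pd_apply {σ : Type*} (s : σ) (P : MvPolynomial σ ℂ) : pd s P = pderiv s P := rfl

theorem pd_X_mul_self {σ : Type*} (s : σ) (P : MvPolynomial σ ℂ) :
    pd s (X s * P) = X s * pd s P + P := by
  simp [pd_apply, add_comm]

theorem pd_X_mul_of_ne {σ : Type*} {s t : σ} (h : s ≠ t) (P : MvPolynomial σ ℂ) :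
    pd s (X t * P) = X t * pd s P := by
  simp [pd_apply, pderiv_X_of_ne h.symm]

theorem commute_pd {σ : Type*} (s t : σ) : Commute (pd s) (pd t) :=
  LinearMap.ext fun P => pderiv_pderiv_comm s t P

theorem pd_pow_comm {σ : Type*} (s t : σ) (r : ℕ) (P : MvPolynomial σ ℂ) :
    (pd s ^ r) (pd t P) = pd t ((pd s ^ r) P) :=
  LinearMap.congr_fun ((commute_pd s t).pow_left r) P

theorem pd_pow_succ {σ : Type*} (s : σ) (r : ℕ) (P : MvPolynomial σ ℂ) :
    (pd s ^ (r + 1)) P = (pd s ^ r) (pd s P) := by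
  rw [pow_succ, Module.End.mul_apply]

theorem pd_pow_X_mul {σ : Type*} (s : σ) (r : ℕ) (P : MvPolynomial σ ℂ) :
    (pd s ^ (r + 1)) (X s * P) = X s * (pd s ^ (r + 1)) P + ((r : ℂ) + 1) • (pd s ^ r) P := by
  induction r generalizing P with
  | zero => simp [pd_X_mul_self]
  | succ r ih =>
    rw [pd_pow_succ, pd_X_mul_self, map_add, ih, pd_pow_succ s r P, pd_pow_succ s (r + 1) P]
    push_cast
    module

variable {m : ℕ}

theorem euler_pd {c : ℂ} {Q : MvPolynomial (Fin m) ℂ} (h : ∑ t, X t * pd t Q = c • Q)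
    (s : Fin m) : ∑ t, X t * pd t (pd s Q) = (c - 1) • pd s Q := by
  have h1 := congrArg (pd s) h
  have h2 (t : Fin m) : pd s (X t * pd t Q) = X t * pd t (pd s Q) + if t = s then pd s Q else 0 := by
    split_ifs with hts
    · subst hts; rw [pd_X_mul_self]
    · rw [pd_X_mul_of_ne (Ne.symm hts), add_zero, pd_apply, pd_apply, pd_apply, pd_apply,
        pderiv_pderiv_comm]
  rw [map_sum, map_smul] at h1
  simp only [h2, Finset.sum_add_distrib, Finset.sum_ite_eq', Finset.mem_univ, if_true] at h1
  rw [sub_smul, one_smul, ← h1, add_sub_cancel_right]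

theorem euler_pd_pow {c : ℂ} {Q : MvPolynomial (Fin m) ℂ} (h : ∑ t, X t * pd t Q = c • Q)
    (s : Fin m) (r : ℕ) :
    ∑ t, X t * pd t ((pd s ^ r) Q) = (c - r) • (pd s ^ r) Q := by
  induction r generalizing Q c with
  | zero => simpa using h
  | succ r ih =>
    rw [pd_pow_succ, ih (euler_pd h s)]
    push_cast
    congr 1
    ring

theorem eq_zero_of_pd {c : ℂ} (hc : c ≠ 0) {Q : MvPolynomial (Fin m) ℂ}
    (h : ∑ t, X t * pd t Q = c • Q) (hQ : ∀ t, pd t Q = 0) : Q = 0 := by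
  simp only [hQ, mul_zero, Finset.sum_const_zero] at h
  exact (smul_eq_zero.mp h.symm).resolve_left hc

variable {V : Type*} [AddCommGroup V] [Module ℂ V]
  [LieRingModule (gl m) V] [LieModule ℂ (gl m) V]

theorem euler_contract (ψ : V →ₗ[ℂ] ℂ) {k : ℕ} {z : MvPolynomial (Fin m) ℂ ⊗[ℂ] V}
    (hz : z ∈ singular m V k) :
    ∑ t, X t * pd t (contract ψ z) = (k : ℂ) • contract ψ z := by
  rw [← map_smul, ← hz.1, WeylGL.euler, LinearMap.sum_apply, map_sum]
  simp only [Module.End.mul_apply, contract_y, contract_d, pd_apply]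

/-- With the derivatives on the left, contraction with a functional passes through them and meets
`levi s t z`, which is singular again when `z` is. The reordering costs the extra term `m ∂_s`. -/
theorem WeylGL.raise_eq {σ A : Type*} [DecidableEq σ] [Fintype σ] [Ring A] (D : WeylGL σ A)
    (s : σ) : D.raise s = ∑ t, D.d t * D.levi s t + Fintype.card σ • D.d s := by
  have h (t : σ) : D.levi s t * D.d t = D.d t * D.levi s t + D.d s := by
    rw [mul_eq_add_bracket, D.levi_d, if_pos rfl]
  simp [WeylGL.raise, h, Finset.sum_add_distrib]

theorem WeylGL.e_mul_y_mul_d {σ A : Type*} [DecidableEq σ] [Ring A] (D : WeylGL σ A)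
    (s t q r : σ) : D.e s t * (D.y q * D.d r) = D.y q * D.d r * D.e s t := by
  rw [mul_eq_add_bracket, bracket_mul, D.e_y, D.e_d, zero_mul, mul_zero, add_zero, add_zero]

theorem contract_raise (ψ : V →ₗ[ℂ] ℂ) {k : ℕ} {z : MvPolynomial (Fin m) ℂ ⊗[ℂ] V}
    (hz : z ∈ singular m V k) (s : Fin m) :
    ∑ t, pd t (contract ψ ((ops m V).levi s t z)) + (m : ℂ) • pd s (contract ψ z) = 0 := by
  have h := congrArg (contract ψ) (hz.2 s)
  rw [WeylGL.raise_eq, LinearMap.add_apply, LinearMap.sum_apply, map_add, map_sum,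
    LinearMap.smul_apply, map_nsmul, contract_d, map_zero, Fintype.card_fin] at h
  simp only [Module.End.mul_apply, contract_d] at h
  rw [← h, Nat.cast_smul_eq_nsmul]
  rfl

namespace IsTopFunctional

variable {μ : Fin m → ℂ} {v : V} {φ : V →ₗ[ℂ] ℂ} (hφ : IsTopFunctional μ v φ)
include hφ

/-- The common kernel of all functionals that contract the singular space to zero is a
`gl(m)`-submodule, since that space is Levi-stable. It misses `v`, hence is zero, and it contains
every coefficient of every singular vector. -/
theorem eq_zero_of_contract {k : ℕ} (h : ∀ z ∈ singular m V k, contract φ z = 0) :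
    singular m V k = ⊥ := by
  have := hφ.irreducible
  let K : LieSubmodule ℂ (gl m) V :=
    { carrier := {u | ∀ ψ : V →ₗ[ℂ] ℂ, (∀ z ∈ singular m V k, contract ψ z = 0) → ψ u = 0}
      zero_mem' := fun ψ _ => map_zero ψ
      add_mem' := fun ha hb ψ hψ => by rw [map_add, ha ψ hψ, hb ψ hψ, add_zero]
      smul_mem' := fun c x hx ψ hψ => by rw [map_smul, hx ψ hψ, smul_zero]
      lie_mem := fun {A u} hu ψ hψ => by
        rw [← sum_lie_single, map_sum]
        refine Finset.sum_eq_zero fun s _ => ?_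
        rw [map_sum]
        refine Finset.sum_eq_zero fun t _ => ?_
        rw [map_smul]
        refine smul_eq_zero_of_right _
          (hu (ψ ∘ₗ (LieModule.toEnd ℂ (gl m) V (eij s t) : V →ₗ[ℂ] V)) fun z hz => ?_)
        have h1 := hψ _ (levi_mem_singular hz s t)
        rwa [contract_levi, hψ z hz, map_zero, mul_zero, sub_zero] at h1 }
  have hK : K = ⊥ := by
    refine (eq_bot_or_eq_top K).resolve_right fun htop => ?_
    have hv : v ∈ K := htop ▸ LieSubmodule.mem_top v
    have := hv φ h
    rw [hφ.apply_top] at this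
    exact one_ne_zero this
  refine (Submodule.eq_bot_iff _).mpr fun z hz => eq_zero_of_tcoeff fun α => ?_
  have : tcoeff α z ∈ K := fun ψ hψ => by rw [← coeff_contract, hψ z hz, coeff_zero]
  rwa [hK, LieSubmodule.mem_bot] at this

variable {ibar : ℕ} (hμ₁ : ∀ i j : Fin m, (i : ℕ) < ibar → (j : ℕ) < ibar → μ i = μ j)
  (hμ₂ : ∀ i j : Fin m, ibar ≤ (i : ℕ) → ibar ≤ (j : ℕ) → μ i = μ j)
include hμ₁ hμ₂

/-- Outside the upper right block, `φ ∘ e_{s,t}` is `0` or `μ s • φ`, so `levi s t` descends to a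
first-order operator on the contraction. -/
theorem contract_levi_top {s t : Fin m} (hst : ¬ ((s : ℕ) < ibar ∧ ibar ≤ (t : ℕ)))
    (z : MvPolynomial (Fin m) ℂ ⊗[ℂ] V) : contract φ ((ops m V).levi s t z) =
      (if s = t then μ s • contract φ z else 0) - X t * pd s (contract φ z) := by
  rw [contract_levi, pd_apply]
  congr 1
  split_ifs with h
  · subst h
    rw [← contract_smul]
    exact contract_congr (fun u => hφ.apply_diag s u) z
  · rw [← contract_zero (V := V) z]
    refine contract_congr (fun u => ?_) z
    rcases lt_or_gt_of_ne h with h | h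
    · refine hφ.apply_upper h (fun i h1 h2 => ?_) u
      have h1' : (s : ℕ) ≤ i := h1
      have h2' : (i : ℕ) ≤ t := h2
      rcases lt_or_ge (s : ℕ) ibar with hs | hs
      · exact hμ₁ _ _ (by omega) hs
      · exact hμ₂ _ _ (by omega) hs
    · exact hφ.apply_lower t s h u

/-- For `s` in the second block every `levi s t` descends. The `m` terms `-∂_s Q` cancel the
reordering term, and Euler's identity for `∂_s Q`, of degree `k - 1`, gives the factor. -/
theorem pd_contract_of_le {k : ℕ} {z : MvPolynomial (Fin m) ℂ ⊗[ℂ] V} (hz : z ∈ singular m V k)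
    {s : Fin m} (hs : ibar ≤ (s : ℕ)) : (μ s + 1 - k) • pd s (contract φ z) = 0 := by
  have h := contract_raise φ hz s
  have hL (t : Fin m) : pd t (contract φ ((ops m V).levi s t z)) =
      (if s = t then μ s • pd t (contract φ z) else 0) -
        (X t * pd t (pd s (contract φ z)) + pd s (contract φ z)) := by
    rw [hφ.contract_levi_top hμ₁ hμ₂ (by omega), map_sub, pd_X_mul_self]
    split_ifs <;> simp
  simp only [hL, Finset.sum_sub_distrib, Finset.sum_add_distrib,
    euler_pd (euler_contract φ hz) s, Finset.sum_ite_eq, Finset.mem_univ, if_true,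
    Finset.sum_const, Finset.card_univ, Fintype.card_fin, ← Nat.cast_smul_eq_nsmul ℂ] at h
  rw [← h]
  module

/-- For `t` in the second block `levi s t` does not descend, but `h2` applied to the singular vector
`levi s t z` kills its term. Only `ibar` of the `m` terms `-∂_s Q` remain to offset the reordering
term. -/
theorem pd_contract_of_lt (hm : ibar ≤ m) {k : ℕ}
    (h2 : ∀ z ∈ singular m V k, ∀ t : Fin m, ibar ≤ (t : ℕ) → pd t (contract φ z) = 0)
    {z : MvPolynomial (Fin m) ℂ ⊗[ℂ] V} (hz : z ∈ singular m V k) {s : Fin m}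
    (hs : (s : ℕ) < ibar) : (μ s + m + 1 - ibar - k) • pd s (contract φ z) = 0 := by
  have h := contract_raise φ hz s
  have hL (t : Fin m) : pd t (contract φ ((ops m V).levi s t z)) =
      (if s = t then μ s • pd t (contract φ z) else 0) -
        (X t * pd t (pd s (contract φ z)) + if (t : ℕ) < ibar then pd s (contract φ z) else 0) := by
    by_cases ht : (t : ℕ) < ibar
    · rw [hφ.contract_levi_top hμ₁ hμ₂ (by omega), map_sub, pd_X_mul_self, if_pos ht]
      split_ifs <;> simp
    · have h3 : pd t (pd s (contract φ z)) = 0 := by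
        rw [← pow_one (pd t), pd_pow_comm, pow_one, h2 z hz t (by omega), map_zero]
      have hst : s ≠ t := by rintro rfl; exact ht hs
      rw [h2 _ (levi_mem_singular hz s t) t (by omega), h3, if_neg hst, if_neg ht]
      simp
  have hcard : (Finset.univ.filter fun t : Fin m => (t : ℕ) < ibar).card = ibar := by
    rw [Fin.card_filter_val_lt, min_eq_right hm]
  simp only [hL, Finset.sum_sub_distrib, Finset.sum_add_distrib,
    euler_pd (euler_contract φ hz) s, Finset.sum_ite_eq, Finset.mem_univ, if_true,
    ← Finset.sum_filter, Finset.sum_const, hcard, ← Nat.cast_smul_eq_nsmul ℂ] at h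
  rw [← h]
  module

/-- If the difference of the two values of `μ` is a natural number `n < k` then there are no
singular vectors of degree `k` whose contraction does not involve the second block. -/
theorem contract_eq_zero_of_natCast {k n : ℕ} (hnk : n < k)
    (h2 : ∀ z ∈ singular m V k, ∀ t : Fin m, ibar ≤ (t : ℕ) → pd t (contract φ z) = 0)
    {s t : Fin m} (hs : (s : ℕ) + 1 = ibar) (ht : (t : ℕ) = ibar) (hn : μ s - μ t = n)
    {z : MvPolynomial (Fin m) ℂ ⊗[ℂ] V} (hz : z ∈ singular m V k) : contract φ z = 0 := by
  have hst : s ≠ t := by rintro rfl; omega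
  -- Writing `e_{s,t} = levi s t + y_t ∂_s` and using that singular vectors contract to polynomials
  -- free of `y_t`, the contraction of `e_{s,t}^r z` has degree at most `r` in `y_t`, with `y_t^r`
  -- coefficient `∂_s^r` of the contraction of `z`.
  have key (r : ℕ) : ∀ z ∈ singular m V k,
      (pd t ^ r) (contract φ (((ops m V).e s t ^ r) z)) =
        (r.factorial : ℂ) • (pd s ^ r) (contract φ z) ∧
      (pd t ^ (r + 1)) (contract φ (((ops m V).e s t ^ r) z)) = 0 := by
    induction r with
    | zero => intro z hz; simp [h2 z hz t ht.ge]
    | succ r ih =>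
      intro z hz
      have hcomm : contract φ (((ops m V).e s t ^ (r + 1)) z) =
          contract φ (((ops m V).e s t ^ r) ((ops m V).levi s t z)) +
            X t * pd s (contract φ (((ops m V).e s t ^ r) z)) := by
        have h3 : Commute ((ops m V).e s t ^ r) ((ops m V).y t * (ops m V).d s) := by
          refine Commute.pow_left ?_ r
          exact WeylGL.e_mul_y_mul_d _ s t t s
        have h4 : (ops m V).e s t ^ (r + 1) = (ops m V).e s t ^ r * (ops m V).levi s t +
            (ops m V).y t * (ops m V).d s * (ops m V).e s t ^ r := by
          rw [← h3.eq, ← mul_add, WeylGL.levi, sub_add_cancel, pow_succ]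
        rw [h4, LinearMap.add_apply, map_add]
        simp only [Module.End.mul_apply, contract_y, contract_d]
        rfl
      obtain ⟨i1, i2⟩ := ih z hz
      obtain ⟨-, j2⟩ := ih _ (levi_mem_singular hz s t)
      have j3 : (pd t ^ (r + 1 + 1))
          (contract φ (((ops m V).e s t ^ r) ((ops m V).levi s t z))) = 0 := by
        rw [pow_succ', Module.End.mul_apply, j2, map_zero]
      have i3 : (pd t ^ (r + 1 + 1)) (contract φ (((ops m V).e s t ^ r) z)) = 0 := by
        rw [pow_succ', Module.End.mul_apply, i2, map_zero]
      constructor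
      · rw [hcomm, map_add, j2, pd_pow_X_mul, pd_pow_comm, pd_pow_comm, i1, i2, map_zero, mul_zero,
          zero_add, zero_add, map_smul, smul_smul, Nat.factorial_succ, pow_succ',
          Module.End.mul_apply]
        push_cast
        rfl
      · rw [hcomm, map_add, j3, pd_pow_X_mul, pd_pow_comm, pd_pow_comm, i2, i3]
        simp
  have hbase : ∀ z ∈ singular m V k, (pd s ^ (n + 1)) (contract φ z) = 0 := by
    intro z hz
    have h3 (r : ℕ) (ψ : V →ₗ[ℂ] ℂ) (z) : contract ψ (((ops m V).e s t ^ r) z) =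
        contract (ψ ∘ₗ ((LieModule.toEnd ℂ (gl m) V (eij s t) : V →ₗ[ℂ] V) ^ r)) z := by
      induction r generalizing z with
      | zero => rfl
      | succ r ih => rw [pow_succ, Module.End.mul_apply, ih, contract_e]; rfl
    have h4 := (key (n + 1) z hz).1
    rw [h3, contract_congr (ψ' := 0) (fun u => hφ.apply_pow_simple (by omega) hn u),
      contract_zero, map_zero] at h4
    exact (smul_eq_zero.mp h4.symm).resolve_left (Nat.cast_ne_zero.mpr (Nat.factorial_ne_zero _))
  -- Descent in `r`: `∂_s^r Q` has nonzero degree `k - r`, so it vanishes once its partial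
  -- derivatives do. For another first-block index `q`, apply the hypothesis to `levi q s z`, which
  -- contracts to `-y_s ∂_q Q`.
  have hdown (r : ℕ) (hr : r ≤ k) (h : ∀ z ∈ singular m V k, (pd s ^ r) (contract φ z) = 0) :
      ∀ z ∈ singular m V k, contract φ z = 0 := by
    induction r with
    | zero => simpa using h
    | succ r ih =>
      refine ih (by omega) fun z hz => ?_
      refine eq_zero_of_pd (c := k - r) ?_ (euler_pd_pow (euler_contract φ hz) s r) fun q => ?_
      · rw [sub_ne_zero]
        exact_mod_cast (by omega : k ≠ r)
      · by_cases hq : ibar ≤ (q : ℕ)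
        · rw [← pd_pow_comm, h2 z hz q hq, map_zero]
        · by_cases hqs : q = s
          · subst hqs
            rw [← Module.End.mul_apply, ← pow_succ', h z hz]
          · have h5 := h _ (levi_mem_singular hz q s)
            rw [hφ.contract_levi_top hμ₁ hμ₂ (by omega), if_neg hqs, zero_sub, map_neg, neg_eq_zero,
              pd_pow_X_mul, pd_pow_comm, h z hz, map_zero, mul_zero, zero_add, pd_pow_comm] at h5
            exact (smul_eq_zero.mp h5).resolve_left (Nat.cast_add_one_ne_zero r)
  exact hdown (n + 1) hnk hbase z hz

theorem reducible_necessary (h1 : 1 ≤ ibar) (hm : ibar ≤ m) {k : ℕ} (hk : 0 < k)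
    (hsing : singular m V k ≠ ⊥) :
    ((∃ hi : ibar < m, ∃ l : ℕ, 0 < l ∧
        μ ⟨ibar - 1, by omega⟩ + (m : ℂ) + 1 - (ibar : ℂ) = (l : ℂ) ∧
        ∀ n : ℕ, n < l → μ ⟨ibar - 1, by omega⟩ - μ ⟨ibar, hi⟩ ≠ (n : ℂ)) ∨
      ∃ n : ℕ, 0 < n ∧ μ ⟨m - 1, by omega⟩ + 1 = (n : ℂ)) := by
  by_cases hb : μ ⟨m - 1, by omega⟩ + 1 = (k : ℂ)
  · exact Or.inr ⟨k, hk, hb⟩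
  have h2 : ∀ z ∈ singular m V k, ∀ t : Fin m, ibar ≤ (t : ℕ) → pd t (contract φ z) = 0 := by
    intro z hz t ht
    refine (smul_eq_zero.mp (hφ.pd_contract_of_le hμ₁ hμ₂ hz ht)).resolve_left ?_
    rw [hμ₂ t ⟨m - 1, by omega⟩ ht (by simp; omega), sub_eq_zero]
    exact hb
  have ha : μ ⟨ibar - 1, by omega⟩ + (m : ℂ) + 1 - (ibar : ℂ) = (k : ℂ) := by
    by_contra ha
    refine hsing (hφ.eq_zero_of_contract fun z hz => ?_)
    refine eq_zero_of_pd (Nat.cast_ne_zero.mpr hk.ne') (euler_contract φ hz) fun t => ?_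
    by_cases ht : ibar ≤ (t : ℕ)
    · exact h2 z hz t ht
    · refine (smul_eq_zero.mp (hφ.pd_contract_of_lt hμ₁ hμ₂ hm h2 hz (by omega))).resolve_left ?_
      rw [hμ₁ t ⟨ibar - 1, by omega⟩ (by omega) (by simp; omega), sub_eq_zero]
      exact ha
  rcases hm.lt_or_eq with hi | rfl
  · refine Or.inl ⟨hi, k, hk, ha, fun n hn h => hsing (hφ.eq_zero_of_contract fun z hz => ?_)⟩
    exact hφ.contract_eq_zero_of_natCast hμ₁ hμ₂ hn h2 (by simp; omega) rfl h hz
  -- With no second block the two numerical conditions coincide.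
  · refine absurd ?_ hb
    rw [← ha]
    ring

end IsTopFunctional

end Necessary

end GVM

namespace GVM

/-! ### Singular vectors -/

namespace WeylGL

variable {m : ℕ} {A : Type*} [Ring A] (D : WeylGL (Fin m) A)

theorem levi_e (s t q r : Fin m) : ⁅D.levi s t, D.e q r⁆ =
    (if t = q then D.e s r else 0) - (if r = s then D.e q t else 0) := by
  rw [levi, sub_lie, mul_bracket, D.d_e, D.y_e, D.e_e]
  simp

/-- The element `∑_{t > i} y_t e_{t,i}`. -/
def lower (i : Fin m) : A := ∑ t ∈ Finset.Ioi i, D.y t * D.e t i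

variable {i : Fin m}

theorem levi_lower {s t : Fin m} (hs : s ≠ i) (ht : i < t) :
    ⁅D.levi s t, D.lower i⁆ = if s < i then D.y t * D.e s i else 0 := by
  simp only [lower, lie_sum, bracket_mul, D.levi_y, D.levi_e, if_neg hs.symm, sub_zero, neg_mul,
    Finset.sum_add_distrib, Finset.sum_neg_distrib, ite_mul, zero_mul, mul_ite, mul_zero,
    Finset.sum_ite_eq, Finset.sum_ite_eq', Finset.mem_Ioi, if_pos ht]
  rcases lt_or_gt_of_ne hs with h | h
  · simp [h, h.not_gt]
  · simp [h, h.not_gt]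

theorem e_lower {s : Fin m} (hs : s ≠ i) : ⁅D.e s i, D.lower i⁆ = 0 := by
  rw [lower, lie_sum]
  refine Finset.sum_eq_zero fun j hj => ?_
  rw [bracket_mul, D.e_y, D.e_e, if_neg (Finset.mem_Ioi.mp hj).ne, if_neg hs.symm]
  simp

theorem lower_e {s : Fin m} (hs : s ≠ i) : ⁅D.lower i, D.e s i⁆ = 0 := by
  rw [← lie_skew, D.e_lower hs, neg_zero]

theorem e_self_lower : ⁅D.e i i, D.lower i⁆ = -D.lower i := by
  rw [lower, lie_sum, ← Finset.sum_neg_distrib]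
  refine Finset.sum_congr rfl fun j hj => ?_
  rw [bracket_mul, D.e_y, D.e_e, if_neg (Finset.mem_Ioi.mp hj).ne, if_pos rfl]
  simp

theorem e_upper_lower {t : Fin m} (ht : i < t) : ⁅D.e i t, D.lower i⁆ =
    D.y t * D.e i i - ∑ j ∈ Finset.Ioi i, D.y j * D.e j t := by
  simp [lower, lie_sum, bracket_mul, D.e_y, D.e_e, mul_sub, Finset.sum_sub_distrib, ht]

theorem d_lower (t : Fin m) : ⁅D.d t, D.lower i⁆ = if i < t then D.e t i else 0 := by
  simp [lower, lie_sum, bracket_mul, D.d_y, D.d_e]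

theorem y_lower (t : Fin m) : ⁅D.y t, D.lower i⁆ = 0 := by
  simp [lower, lie_sum, bracket_mul, D.y_y, D.y_e]

theorem lower_y (t : Fin m) : ⁅D.lower i, D.y t⁆ = 0 := by
  rw [← lie_skew, D.y_lower, neg_zero]

theorem euler_lower : ⁅D.euler, D.lower i⁆ = D.lower i := by
  have h (s t : Fin m) : ⁅D.euler, D.e s t⁆ = 0 := by rw [← lie_skew, D.e_euler, neg_zero]
  simp [lower, lie_sum, bracket_mul, D.euler_y, h]

end WeylGL

/-! ### Action of `gl(m + 1)` on the vectors `vec i v q r` -/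

section Construction

open MvPolynomial

variable {m : ℕ} {V : Type*} [AddCommGroup V] [Module ℂ V]
  [LieRingModule (gl m) V] [LieModule ℂ (gl m) V]

/-- The vectors `y_i ^ q (∑_{t > i} y_t e_{t,i}) ^ r (1 ⊗ v)`. -/
noncomputable def vec (i : Fin m) (v : V) (q r : ℕ) : MvPolynomial (Fin m) ℂ ⊗[ℂ] V :=
  ((ops m V).y i ^ q) (((ops m V).lower i ^ r) (1 ⊗ₜ v))

theorem vec_succ_left (i : Fin m) (v : V) (q r : ℕ) :
    vec i v (q + 1) r = (ops m V).y i (vec i v q r) := by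
  rw [vec, pow_succ', Module.End.mul_apply, vec]

theorem vec_zero_succ (i : Fin m) (v : V) (r : ℕ) :
    vec i v 0 (r + 1) = (ops m V).lower i (vec i v 0 r) := by
  simp [vec, pow_succ']

theorem lower_vec (i : Fin m) (v : V) (q r : ℕ) :
    (ops m V).lower i (vec i v q r) = vec i v q (r + 1) := by
  induction q with
  | zero => rw [vec_zero_succ]
  | succ q ih =>
    rw [vec_succ_left, vec_succ_left, ← ih, apply_apply_eq ((ops m V).y i), WeylGL.y_lower,
      LinearMap.zero_apply, add_zero]

theorem y_mul_pred (i : Fin m) (v : V) (q r : ℕ) :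
    (q : ℂ) • (ops m V).y i (vec i v (q - 1) r) = (q : ℂ) • vec i v q r := by
  cases q with
  | zero => simp
  | succ q => rw [Nat.add_sub_cancel, vec_succ_left]

theorem lower_pred (i : Fin m) (v : V) (q r : ℕ) :
    (r : ℂ) • (ops m V).lower i (vec i v q (r - 1)) = (r : ℂ) • vec i v q r := by
  cases r with
  | zero => simp
  | succ r => rw [Nat.add_sub_cancel, lower_vec]

theorem euler_vec (i : Fin m) (v : V) (q r : ℕ) :
    (ops m V).euler (vec i v q r) = ((q : ℂ) + r) • vec i v q r := by
  induction q with
  | zero =>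
    induction r with
    | zero => simp [vec, ops_euler_one_tmul]
    | succ r ih =>
      rw [vec_zero_succ, apply_apply_eq, ih, WeylGL.euler_lower, map_smul]
      push_cast
      module
  | succ q ih =>
    rw [vec_succ_left, apply_apply_eq, ih, WeylGL.euler_y, map_smul]
    push_cast
    module

theorem d_vec_of_lt {i t : Fin m} (ht : t < i) (v : V) (q r : ℕ) :
    (ops m V).d t (vec i v q r) = 0 := by
  induction q with
  | zero =>
    induction r with
    | zero => simp [vec]
    | succ r ih =>
      rw [vec_zero_succ, apply_apply_eq, ih, WeylGL.d_lower, if_neg ht.not_gt]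
      simp
  | succ q ih =>
    rw [vec_succ_left, apply_apply_eq, ih, WeylGL.d_y, if_neg ht.ne]
    simp

theorem d_vec_self (i : Fin m) (v : V) (q r : ℕ) :
    (ops m V).d i (vec i v q r) = (q : ℂ) • vec i v (q - 1) r := by
  induction q with
  | zero =>
    induction r with
    | zero => simp [vec]
    | succ r ih =>
      rw [vec_zero_succ, apply_apply_eq, ih, WeylGL.d_lower, if_neg (lt_irrefl i)]
      simp
  | succ q ih =>
    rw [vec_succ_left, apply_apply_eq, ih, WeylGL.d_y, if_pos rfl, map_smul, y_mul_pred,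
      Nat.add_sub_cancel, Module.End.one_apply]
    push_cast
    module

theorem e_y_apply (s t r : Fin m) (z : MvPolynomial (Fin m) ℂ ⊗[ℂ] V) :
    (ops m V).e s t ((ops m V).y r z) = (ops m V).y r ((ops m V).e s t z) := by
  rw [apply_apply_eq, WeylGL.e_y, LinearMap.zero_apply, add_zero]

theorem d_vec_of_gt {i t : Fin m} (ht : i < t) (v : V) (q r : ℕ) :
    (ops m V).d t (vec i v q r) = (r : ℂ) • (ops m V).e t i (vec i v q (r - 1)) := by
  induction q with
  | zero =>
    induction r with
    | zero => simp [vec]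
    | succ r ih =>
      rw [vec_zero_succ, apply_apply_eq, ih, WeylGL.d_lower, if_pos ht, map_smul,
        apply_apply_eq _ ((ops m V).e t i), WeylGL.lower_e _ ht.ne',
        LinearMap.zero_apply, add_zero, ← map_smul, lower_pred, map_smul, Nat.add_sub_cancel]
      push_cast
      module
  | succ q ih =>
    rw [vec_succ_left, apply_apply_eq, ih, WeylGL.d_y, if_neg ht.ne', map_smul,
      LinearMap.zero_apply, add_zero, vec_succ_left, e_y_apply]

namespace IsTopFunctional

variable {μ : Fin m → ℂ} {v : V} {φ : V →ₗ[ℂ] ℂ} (hφ : IsTopFunctional μ v φ) {i : Fin m}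
include hφ

theorem e_vec_of_lt {s : Fin m} (hs : s < i) (q r : ℕ) : (ops m V).e s i (vec i v q r) = 0 := by
  induction q with
  | zero =>
    induction r with
    | zero => simp [vec, hφ.lie_of_lt s i hs]
    | succ r ih => rw [vec_zero_succ, apply_apply_eq, ih, WeylGL.e_lower _ hs.ne]; simp
  | succ q ih => rw [vec_succ_left, e_y_apply, ih, map_zero]

theorem e_vec_self (q r : ℕ) : (ops m V).e i i (vec i v q r) = (μ i - r) • vec i v q r := by
  induction q with
  | zero =>
    induction r with
    | zero => simp [vec, hφ.lie_self]
    | succ r ih =>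
      rw [vec_zero_succ, apply_apply_eq, ih, WeylGL.e_self_lower, LinearMap.neg_apply, map_smul]
      push_cast
      module
  | succ q ih => rw [vec_succ_left, e_y_apply, ih, map_smul]

variable {b : ℂ} (hb : ∀ t, i < t → μ t = b)
include hb

/-- Moving `levi s t` past `lower i` produces at most `y_t e_{s,i}` with `s < i`, which annihilates
these vectors; `y_i` is not affected as `s ≠ i`. So the action on `v` decides, where `v` is killed
by lower units inside the constant block after `i`. -/
theorem levi_vec {s t : Fin m} (hs : s ≠ i) (ht : i < t) (q r : ℕ) :
    (ops m V).levi s t (vec i v q r) = if s = t then b • vec i v q r else 0 := by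
  induction q with
  | zero =>
    induction r with
    | zero =>
      have hv : ⁅eij s t, v⁆ = if s = t then b • v else 0 := by
        split_ifs with h
        · subst h; rw [hφ.lie_self, hb _ ht]
        · rcases lt_or_gt_of_ne h with h | h
          · exact hφ.lie_of_lt s t h
          · exact hφ.lower_top h fun j h1 _ => by rw [hb j (ht.trans_le h1), hb t ht]
      simp only [vec, pow_zero, Module.End.one_apply, ops_levi_one_tmul, hv]
      split_ifs <;> simp
    | succ r ih =>
      rw [vec_zero_succ, apply_apply_eq, ih, WeylGL.levi_lower _ hs ht]
      have h0 : (if s < i then (ops m V).y t * (ops m V).e s i else 0) (vec i v 0 r) = 0 := by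
        split_ifs with h
        · rw [Module.End.mul_apply, hφ.e_vec_of_lt h, map_zero]
        · rfl
      rw [h0, add_zero]
      split_ifs <;> simp
  | succ q ih =>
    rw [vec_succ_left, apply_apply_eq, ih, WeylGL.levi_y, if_neg hs.symm]
    split_ifs <;> simp

/-- With `c = μ i - b`, passing from `r` to `r + 1` adds `c - 2 r` to the scalar: `μ i - r` from
`e_{i,i}`, minus `b + r` from the sum over `j > i`. These increments add up to the `sl(2)` value `r
(c - (r - 1))`. -/
theorem e_upper_vec {t : Fin m} (ht : i < t) (q r : ℕ) : (ops m V).e i t (vec i v q r) =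
    (r * (μ i - b - (r - 1)) : ℂ) • (ops m V).y t (vec i v q (r - 1)) := by
  induction q with
  | zero =>
    induction r with
    | zero => simp [vec, hφ.lie_of_lt i t ht]
    | succ r ih =>
      have hsum : (∑ j ∈ Finset.Ioi i, (ops m V).y j * (ops m V).e j t) (vec i v 0 r) =
          (b + r) • (ops m V).y t (vec i v 0 r) := by
        have h1 (j : Fin m) (hj : j ∈ Finset.Ioi i) :
            ((ops m V).y j * (ops m V).e j t) (vec i v 0 r) =
              (if j = t then b • (ops m V).y j (vec i v 0 r) else 0) +
              (r : ℂ) • (ops m V).y t (((ops m V).y j * (ops m V).e j i) (vec i v 0 (r - 1))) := by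
          have h2 : (ops m V).e j t = (ops m V).levi j t + (ops m V).y t * (ops m V).d j := by
            rw [WeylGL.levi, sub_add_cancel]
          rw [Module.End.mul_apply, h2, LinearMap.add_apply,
            hφ.levi_vec hb (Finset.mem_Ioi.mp hj).ne' ht, Module.End.mul_apply,
            d_vec_of_gt (Finset.mem_Ioi.mp hj), map_add, Module.End.mul_apply,
            apply_apply_eq ((ops m V).y j) ((ops m V).y t), WeylGL.y_y, map_smul, map_smul]
          split_ifs <;> simp
        rw [LinearMap.sum_apply, Finset.sum_congr rfl h1, Finset.sum_add_distrib,
          Finset.sum_ite_eq', if_pos (Finset.mem_Ioi.mpr ht), ← Finset.smul_sum, ← map_sum,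
          ← LinearMap.sum_apply]
        change _ + (r : ℂ) • (ops m V).y t ((ops m V).lower i _) = _
        rw [← map_smul ((ops m V).y t) (r : ℂ), lower_pred, map_smul, add_smul]
      rw [vec_zero_succ, apply_apply_eq, ih, WeylGL.e_upper_lower _ ht, LinearMap.sub_apply, hsum,
        Module.End.mul_apply, hφ.e_vec_self, map_smul, map_smul, mul_comm (r : ℂ), mul_smul,
        apply_apply_eq _ ((ops m V).y t), WeylGL.lower_y, LinearMap.zero_apply, add_zero,
        ← map_smul ((ops m V).y t) (r : ℂ), lower_pred, map_smul, Nat.add_sub_cancel]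
      push_cast
      module
  | succ q ih =>
    rw [vec_succ_left, e_y_apply, ih, map_smul, apply_apply_eq ((ops m V).y i), WeylGL.y_y,
      LinearMap.zero_apply, add_zero, vec_succ_left]

theorem levi_self_vec {t : Fin m} (ht : i < t) (q r : ℕ) : (ops m V).levi i t (vec i v q r) =
    (r * (μ i - b - (r - 1)) : ℂ) • (ops m V).y t (vec i v q (r - 1)) -
      (q : ℂ) • (ops m V).y t (vec i v (q - 1) r) := by
  rw [WeylGL.levi, LinearMap.sub_apply, hφ.e_upper_vec hb ht, Module.End.mul_apply, d_vec_self,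
    map_smul]

/-- In `∑_t levi j t ∂_t` the indices `t < i` contribute nothing. The index `i` gives the `q` term
and the correction `-r q`, each of the `m - 1 - i` indices `t > i` gives `r`, and `t = j` gives `r
b` besides. -/
theorem raise_vec {j : Fin m} (hj : i < j) (q r : ℕ) : (ops m V).raise j (vec i v q r) =
    (q : ℂ) • (ops m V).e j i (vec i v (q - 1) r) +
      (r * (b + (m - 1 - i : ℕ) - q) : ℂ) • (ops m V).e j i (vec i v q (r - 1)) := by
  have h1 : (ops m V).levi j i ((ops m V).d i (vec i v q r)) =
      (q : ℂ) • (ops m V).e j i (vec i v (q - 1) r) -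
        (r * q : ℂ) • (ops m V).e j i (vec i v q (r - 1)) := by
    rw [d_vec_self, map_smul, WeylGL.levi, LinearMap.sub_apply, Module.End.mul_apply,
      d_vec_of_gt hj, map_smul, ← e_y_apply, smul_sub, smul_comm, ← map_smul _ (q : ℂ) ((ops m V).y i _),
      y_mul_pred, map_smul, mul_smul]
  have h2 (t : Fin m) (ht : i < t) : (ops m V).levi j t ((ops m V).d t (vec i v q r)) =
      (r : ℂ) • ((if j = t then b • (ops m V).e j i (vec i v q (r - 1)) else 0) +
        (ops m V).e j i (vec i v q (r - 1))) := by
    rw [d_vec_of_gt ht, map_smul, apply_apply_eq, hφ.levi_vec hb hj.ne' ht, WeylGL.levi_e,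
      if_pos rfl, if_neg hj.ne, LinearMap.sub_apply, LinearMap.zero_apply, sub_zero]
    split_ifs with h
    · subst h; rw [map_smul]
    · rw [map_zero]
  have h3 : (ops m V).raise j (vec i v q r) =
      ∑ t, (ops m V).levi j t ((ops m V).d t (vec i v q r)) := by
    simp [WeylGL.raise]
  have h4 : (Finset.univ : Finset (Fin m)) = Finset.Iio i ∪ insert i (Finset.Ioi i) := by
    ext t
    simp [lt_or_ge]
  have h5 : Disjoint (Finset.Iio i) (insert i (Finset.Ioi i)) := by
    rw [Finset.disjoint_left]
    intro t ht
    have := Finset.mem_Iio.mp ht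
    simp [this]
  rw [h3, h4, Finset.sum_union h5, Finset.sum_insert (by simp), h1,
    Finset.sum_congr rfl (g := fun _ => 0) fun t ht => by
      rw [d_vec_of_lt (Finset.mem_Iio.mp ht), map_zero],
    Finset.sum_congr (s₁ := Finset.Ioi i) rfl fun t ht => h2 t (Finset.mem_Ioi.mp ht),
    ← Finset.smul_sum, Finset.sum_add_distrib, Finset.sum_ite_eq, if_pos (Finset.mem_Ioi.mpr hj),
    Finset.sum_const_zero, Finset.sum_const, Fin.card_Ioi, ← Nat.cast_smul_eq_nsmul ℂ]
  module

end IsTopFunctional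

end Construction

end GVM

namespace GVM

/-! ### Explicit singular vectors -/

section Sufficient

open MvPolynomial

/-- The coefficients of the singular vector. -/
noncomputable def singularCoeff (c : ℂ) (l q r : ℕ) : ℂ :=
  (∏ j ∈ Finset.Ico r l, (c - j)) / (q.factorial * r.factorial)

theorem singularCoeff_rec (c : ℂ) {l q r : ℕ} (hr : r < l) :
    singularCoeff c l (q + 1) r * (q + 1) =
      singularCoeff c l q (r + 1) * ((r + 1) * (c - r)) := by
  have h1 : (q.factorial : ℂ) ≠ 0 := Nat.cast_ne_zero.mpr (Nat.factorial_ne_zero _)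
  have h2 : (r.factorial : ℂ) ≠ 0 := Nat.cast_ne_zero.mpr (Nat.factorial_ne_zero _)
  have h3 : (q : ℂ) + 1 ≠ 0 := Nat.cast_add_one_ne_zero q
  have h4 : (r : ℂ) + 1 ≠ 0 := Nat.cast_add_one_ne_zero r
  rw [singularCoeff, singularCoeff, Finset.prod_eq_prod_Ico_succ_bot hr, Nat.factorial_succ,
    Nat.factorial_succ]
  push_cast
  field_simp

/-- By `singularCoeff_rec` the two halves cancel after an index shift along the antidiagonal. Since
`f` is arbitrary, the same cancellation serves both `raise t` and `levi i t`. The truncated `p - 1`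
at `p = 0` is harmless: its coefficient vanishes. -/
theorem sum_singularCoeff {M : Type*} [AddCommGroup M] [Module ℂ M] (c : ℂ) (l : ℕ)
    (f : ℕ → ℕ → M) : ∑ p ∈ Finset.HasAntidiagonal.antidiagonal (l + 1), singularCoeff c (l + 1) p.1 p.2 •
      ((p.1 : ℂ) • f (p.1 - 1) p.2 - (p.2 * (c - (p.2 - 1)) : ℂ) • f p.1 (p.2 - 1)) = 0 := by
  simp only [smul_sub, Finset.sum_sub_distrib, smul_smul]
  rw [Finset.Nat.sum_antidiagonal_succ, Finset.Nat.sum_antidiagonal_succ']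
  simp only [Nat.cast_zero, mul_zero, zero_mul, zero_smul, zero_add, Nat.add_sub_cancel,
    Nat.cast_add, Nat.cast_one, add_sub_cancel_right]
  rw [sub_eq_zero]
  refine Finset.sum_congr rfl fun p hp => ?_
  rw [singularCoeff_rec c (by have := Finset.HasAntidiagonal.mem_antidiagonal.mp hp; omega)]

variable {m : ℕ} {V : Type*} [AddCommGroup V] [Module ℂ V]
  [LieRingModule (gl m) V] [LieModule ℂ (gl m) V]
  {μ : Fin m → ℂ} {v : V} {φ : V →ₗ[ℂ] ℂ}

/-- A vector of degree `k` annihilated by `X_t` and by `E_{s,t}` for all `s ≠ t` is singular. -/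
theorem mem_singular_of_levi {k : ℕ} {z : MvPolynomial (Fin m) ℂ ⊗[ℂ] V} {t : Fin m}
    (hk : (ops m V).euler z = (k : ℂ) • z) (ht : (ops m V).raise t z = 0)
    (h : ∀ s, s ≠ t → (ops m V).levi s t z = 0) : z ∈ singular m V k := by
  refine ⟨hk, fun s => ?_⟩
  by_cases hst : s = t
  · rw [hst, ht]
  · have h1 := apply_apply_eq ((ops m V).levi s t) ((ops m V).raise t) z
    rw [ht, h s hst, map_zero, map_zero, WeylGL.levi_raise, if_pos rfl, zero_add] at h1
    exact h1.symm

namespace IsTopFunctional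

variable (hφ : IsTopFunctional μ v φ)
include hφ

theorem contract_lower (i : Fin m) (z : MvPolynomial (Fin m) ℂ ⊗[ℂ] V) :
    contract φ ((ops m V).lower i z) = 0 := by
  rw [WeylGL.lower, LinearMap.sum_apply, map_sum]
  refine Finset.sum_eq_zero fun t ht => ?_
  rw [Module.End.mul_apply, contract_y, contract_e, contract_congr (ψ' := 0)
    (fun u => hφ.apply_lower i t (Finset.mem_Ioi.mp ht) u), contract_zero, mul_zero]

/-- Every factor `lower i` lands in images of lower units, which `φ` kills. This is what certifies
that the explicit singular vectors are nonzero. -/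
theorem contract_vec (i : Fin m) (q r : ℕ) :
    contract φ (vec i v q r) = if r = 0 then X i ^ q else 0 := by
  induction q with
  | zero =>
    cases r with
    | zero => simp [vec, hφ.apply_top]
    | succ r => simp [vec_zero_succ, hφ.contract_lower]
  | succ q ih =>
    rw [vec_succ_left, contract_y, ih]
    split_ifs
    · rw [pow_succ']
    · rw [mul_zero]

/-- The witness is `y_t^k ⊗ v` with `t` the last index: `raise t` multiplies `y_t^(k-1) ⊗ v` by `k
(μ t - (k - 1))`, which is zero. -/
theorem exists_singular_of_last {t : Fin m} (ht : (t : ℕ) + 1 = m) {k : ℕ} (hk : 0 < k)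
    (hμ : μ t + 1 = k) : ∃ w ∈ singular m V k, w ≠ 0 := by
  have hlt (s : Fin m) (hs : s ≠ t) : s < t := by
    have := Fin.val_ne_of_ne hs
    omega
  refine ⟨vec t v k 0, mem_singular_of_levi (t := t) ?_ ?_ fun s hs => ?_, fun h => ?_⟩
  · simpa using euler_vec t v k 0
  · rw [WeylGL.raise, LinearMap.sum_apply, Finset.sum_eq_single t]
    · rw [Module.End.mul_apply, d_vec_self, map_smul, WeylGL.levi, LinearMap.sub_apply,
        hφ.e_vec_self, Module.End.mul_apply, d_vec_self, map_smul, y_mul_pred]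
      obtain ⟨k, rfl⟩ := Nat.exists_eq_succ_of_ne_zero hk.ne'
      have h : μ t = k := by simpa using hμ
      simp [h]
    · intro s _ hs
      rw [Module.End.mul_apply, d_vec_of_lt (hlt s hs), map_zero]
    · simp
  · rw [WeylGL.levi, LinearMap.sub_apply, hφ.e_vec_of_lt (hlt s hs), Module.End.mul_apply,
      d_vec_of_lt (hlt s hs), map_zero, sub_zero]
  · have h1 := congrArg (contract φ) h
    rw [hφ.contract_vec, if_pos rfl, map_zero] at h1
    exact pow_ne_zero _ (X_ne_zero t) h1

theorem exists_singular_of_block {i : Fin m} (hi : (i : ℕ) + 1 < m) {b : ℂ}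
    (hb : ∀ t, i < t → μ t = b) {l : ℕ} (hl : μ i + m - i = (l + 1 : ℕ))
    (hc : ∀ n : ℕ, n < l + 1 → μ i - b ≠ n) : ∃ w ∈ singular m V (l + 1), w ≠ 0 := by
  set c : ℂ := μ i - b with hcdef
  -- Any `t > i` would do for the cancellations, but the remaining operators `levi s t`, `s ≠ t`,
  -- must kill `W` as well; the last index is a convenient choice.
  set t : Fin m := ⟨m - 1, by omega⟩ with ht
  have hit : i < t := by
    rw [Fin.lt_def]
    simp only [ht]
    omega
  set W : MvPolynomial (Fin m) ℂ ⊗[ℂ] V :=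
    ∑ p ∈ Finset.HasAntidiagonal.antidiagonal (l + 1), singularCoeff c (l + 1) p.1 p.2 • vec i v p.1 p.2 with hW
  refine ⟨W, mem_singular_of_levi (t := t) ?_ ?_ fun s hs => ?_, fun h => ?_⟩
  · rw [hW, map_sum, Finset.smul_sum]
    refine Finset.sum_congr rfl fun p hp => ?_
    rw [map_smul, euler_vec, smul_comm, ← Finset.HasAntidiagonal.mem_antidiagonal.mp hp]
    push_cast
    rfl
  · rw [← sum_singularCoeff c l (fun q r => (ops m V).e t i (vec i v q r)), hW, map_sum]
    refine Finset.sum_congr rfl fun p hp => ?_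
    have h1 : ((m - 1 - i : ℕ) : ℂ) = m - 1 - i := by
      rw [Nat.sub_sub, Nat.cast_sub (by omega)]
      push_cast
      ring
    have h2 : (p.1 : ℂ) = l + 1 - p.2 := by
      rw [eq_sub_iff_add_eq]
      exact_mod_cast Finset.HasAntidiagonal.mem_antidiagonal.mp hp
    rw [map_smul, hφ.raise_vec hb hit, h1, sub_eq_add_neg _ (_ • _), ← neg_smul]
    congr 3
    -- The degree condition turns the factor `b + (m - 1 - i) - q` of `raise_vec` into `-(c - (r -
    -- 1))`, exactly the factor cancelled by the recursion.
    have h3 : μ i = l + 1 - m + i := by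
      push_cast at hl
      linear_combination hl
    rw [h2, hcdef, h3]
    ring
  · by_cases hsi : s = i
    · subst hsi
      rw [← neg_zero, ← sum_singularCoeff c l (fun q r => (ops m V).y t (vec s v q r)), hW,
        map_sum, ← Finset.sum_neg_distrib]
      refine Finset.sum_congr rfl fun p _ => ?_
      rw [map_smul, hφ.levi_self_vec hb hit, ← smul_neg, neg_sub]
    · rw [hW, map_sum]
      refine Finset.sum_eq_zero fun p _ => ?_
      rw [map_smul, hφ.levi_vec hb hsi hit, if_neg hs, smul_zero]
  · have h1 := congrArg (contract φ) h
    rw [hW, map_sum, map_zero, Finset.Nat.sum_antidiagonal_succ'] at h1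
    simp only [map_smul, hφ.contract_vec, if_true, if_neg (Nat.succ_ne_zero _), smul_zero,
      Finset.sum_const_zero, add_zero] at h1
    -- The contraction of `W` is this coefficient times `y_i^(l+1)`, and `hc` excludes the zeros `c
    -- = 0, …, l` of its numerator.
    have h2 : singularCoeff c (l + 1) (l + 1) 0 ≠ 0 := by
      refine div_ne_zero (Finset.prod_ne_zero_iff.mpr fun j hj => ?_) ?_
      · exact sub_ne_zero.mpr (hc j (Finset.mem_Ico.mp hj).2)
      · exact mul_ne_zero (Nat.cast_ne_zero.mpr (Nat.factorial_ne_zero _))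
          (Nat.cast_ne_zero.mpr (Nat.factorial_ne_zero _))
    exact (pow_ne_zero _ (X_ne_zero i)) ((smul_eq_zero.mp h1).resolve_left h2)

end IsTopFunctional

end Sufficient

end GVM

theorem theorem4p11 (m ibar : ℕ) (h1 : 1 ≤ ibar) (hm : ibar ≤ m) (μ : Fin m → ℂ)
    -- `μ_1 = … = μ_ibar` and `μ_{ibar+1} = … = μ_m`, where `μ_i` is `μ ⟨i - 1, _⟩`
    (hμ₁ : ∀ i j : Fin m, (i : ℕ) < ibar → (j : ℕ) < ibar → μ i = μ j)
    (hμ₂ : ∀ i j : Fin m, ibar ≤ (i : ℕ) → ibar ≤ (j : ℕ) → μ i = μ j)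
    (V : Type*) [AddCommGroup V] [Module ℂ V]
    [LieRingModule (GVM.gl m) V] [LieModule ℂ (GVM.gl m) V]
    (hV : GVM.IsSimpleHighestWeight μ V) :
    ¬ LieModule.IsIrreducible ℂ (GVM.sl m) (GVM.GeneralizedVerma m V) ↔
      ((∃ hi : ibar < m, ∃ l : ℕ, 0 < l ∧
          μ ⟨ibar - 1, by omega⟩ + (m : ℂ) + 1 - (ibar : ℂ) = (l : ℂ) ∧
          ∀ n : ℕ, n < l → μ ⟨ibar - 1, by omega⟩ - μ ⟨ibar, hi⟩ ≠ (n : ℂ)) ∨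
        ∃ n : ℕ, 0 < n ∧ μ ⟨m - 1, by omega⟩ + 1 = (n : ℂ)) := by
  have := hV.irreducible
  obtain ⟨v, hv, hn, hμ⟩ := hV.exists_highestWeightVector
  obtain ⟨φ, hφ⟩ := GVM.exists_isTopFunctional hv hn hμ
  have : Nontrivial V := ⟨v, 0, hv⟩
  rw [GVM.isIrreducible_generalizedVerma_iff]
  constructor
  · intro h
    obtain ⟨k, hk, hsing⟩ := hφ.exists_singular h
    exact hφ.reducible_necessary hμ₁ hμ₂ h1 hm hk hsing
  · rintro (⟨hi, l, hl, ha, hc⟩ | ⟨n, hn, hb⟩)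
    · obtain _ | l := l
      · exact absurd hl (lt_irrefl 0)
      -- With zero-based indices, `ibar - 1` is the last index of the first block, so all later
      -- weights equal `μ ⟨ibar, hi⟩`.
      obtain ⟨w, hw, hw0⟩ := hφ.exists_singular_of_block (i := ⟨ibar - 1, by omega⟩)
        (b := μ ⟨ibar, hi⟩) (l := l) (by simp; omega)
        (fun t ht => hμ₂ _ _ (by rw [Fin.lt_def] at ht; simp at ht; omega) le_rfl)
        (by
          rw [← ha]
          simp only [Nat.cast_sub h1]
          push_cast
          ring)
        hc
      exact GVM.not_isIrreducible_of_singular l.succ_pos hw hw0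
    · obtain ⟨w, hw, hw0⟩ := hφ.exists_singular_of_last (t := ⟨m - 1, by omega⟩)
        (by simp; omega) hn hb
      exact GVM.not_isIrreducible_of_singular hn hw hw0
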